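/- Let $Q$ be a smooth finite-dimensional manifold with projection $\pi\colon TQ\to Q$, and let $L\colon TQ\to\mathbf R$ be smooth. For a function $f$ on a vector bundle, $\mathrm Df$ denotes its fibre derivative (the derivative of $f$ along the fibres) and $\mathrm D^2f$ its fibre hessian. The Legendre map is ${\cal F}=\mathrm DL\colon TQ\to T^*Q$, and the energy is $E(v)=\langle \mathrm DL(v),v\rangle-L(v)$. Assume that $L$ is almost regular: $\cal F$ has connected fibres and is a submersion onto a closed (embedded) submanifold $P_0={\cal F}(TQ)$ of $T^*Q$. On an open set $O\subset T^*Q$ let the following be given: a hamiltonian $H$, that is, a smooth function with $H\circ{\cal F}=E$ on ${\cal F}^{-1}(O)$; and a finite independent set of primary hamiltonian constraints $\phi_\mu$, that is, smooth functions with $P_0\cap O=\{p\in O:\phi_\mu(p)=0\ \forall\mu\}$ whose differentials are linearly independent at the points of $P_0\cap O$. For a function $h$ on $O$ put $\gamma_h=\mathrm Dh\circ{\cal F}$, with values in $T^{**}Q\cong TQ$, and let $\Gamma_h=(\gamma_h)^{\rm v}$ be the corresponding vertical vector field on ${\cal F}^{-1}(O)$; write $\gamma_\mu=\gamma_{\phi_\mu}$,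 $\Gamma_\mu=\Gamma_{\phi_\mu}$. Here $(\cdot)^{\rm v}$ denotes the identifications $V_v(TQ)\cong T_{\pi(v)}Q$ and $V^*_v(TQ)\cong T^*_{\pi(v)}Q$ given by the vertical lift, where $V(TQ)=\ker T\pi$. A vector $X\in T_v(TQ)$ is of second order if $T\pi(X)=v$, and $N(TQ)$ is the set of these vectors. The Euler–Lagrange operator $\widehat{\delta L}\colon N(TQ)\to V^*(TQ)$ is, under these identifications and in natural coordinates $(q,v)$ of $TQ$, $$\widehat{\delta L}(X)=\Big(\frac{\partial L}{\partial q^i}-X\Big(\frac{\partial L}{\partial v^i}\Big)\Big)\,dq^i .$$ Let $V_1\subset TQ$ be the set of points $v$ for which there is a second-order vector $X\in T_v(TQ)$ with $\widehat{\delta L}(X)=0$. A primary dynamical field on an open set $U\subset TQ$ is a smooth second-order vector field $X$ on $U$ with $\widehat{\delta L}\circ X=0$ on $V_1\cap U$. Then there are smooth functions $\lambda^\mu$ on ${\cal F}^{-1}(O)$ such that $$ v=\gamma_H(v)+\sum_\mu\lambda^\mu(v)\,\gamma_\mu(v) \qquad (*)$$ for every $v\in{\cal F}^{-1}(O)$.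 Moreover, let $U\subset{\cal F}^{-1}(O)$ be open, let $\lambda^\mu$ be any smooth functions on $U$ satisfying $(*)$ on $U$, and let $\widehat{\cal M}\colon V^*(TQ)|_U\to V(TQ)|_U$ be the operator corresponding to $$M=(\mathrm D^2H\circ{\cal F})+\sum_\mu\lambda^\mu\,(\mathrm D^2\phi_\mu\circ{\cal F})\colon U\to\mathrm{Hom}(T^*Q,TQ).$$ Then for every smooth second-order vector field $X_0$ on $U$, the field $$D_0=X_0+\widehat{\cal M}\circ(\widehat{\delta L}\circ X_0)$$ is a primary dynamical field on $U$. More precisely, with $\chi_\mu=\langle\widehat{\delta L}\circ X_0,\Gamma_\mu\rangle$, one has on $U$ $$\widehat{\delta L}\circ D_0=\sum_\mu\chi_\mu\,(\mathrm D\lambda^\mu)^{\rm v},$$ and the right-hand side vanishes on $V_1\cap U$. -/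

import Mathlib

open Bundle Set
open scoped Manifold ContDiff Topology

namespace SingularLagrangian

noncomputable section

/-! ### The tangent and cotangent bundles of a manifold `Q` modelled on `E` -/

section Bundles

variable (E : Type*) [NormedAddCommGroup E] [NormedSpace ℝ E]
  (Q : Type*) [TopologicalSpace Q] [ChartedSpace E Q]

/-- The tangent bundle `TQ`. -/
abbrev TQ := TangentBundle 𝓘(ℝ, E) Q

/-- The cotangent bundle `T*Q`. -/
abbrev CoTQ [IsManifold 𝓘(ℝ, E) ∞ Q] :=
  TotalSpace (E →L[ℝ] ℝ) (fun q : Q => TangentSpace 𝓘(ℝ, E) q →L[ℝ] ℝ)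

/-- The model with corners of `TQ`. -/
abbrev modelTQ : ModelWithCorners ℝ (E × E) (ModelProd E E) := 𝓘(ℝ, E).tangent

/-- The model with corners of `T*Q`. -/
abbrev modelCoTQ : ModelWithCorners ℝ (E × (E →L[ℝ] ℝ)) (ModelProd E (E →L[ℝ] ℝ)) :=
  𝓘(ℝ, E).prod 𝓘(ℝ, E →L[ℝ] ℝ)

end Bundles

/-! ### Embedded submanifolds -/

section Submanifolds

variable {G : Type*} [NormedAddCommGroup G] [NormedSpace ℝ G]
  {K : Type*} [TopologicalSpace K] (J : ModelWithCorners ℝ G K)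
  {N : Type*} [TopologicalSpace N] [ChartedSpace K N]

/-- The differential of a real function at a point, as a covector. -/
def differential (f : N → ℝ) (p : N) : TangentSpace J p →L[ℝ] ℝ :=
  mfderiv J 𝓘(ℝ, ℝ) f p

/-- `S` is an embedded submanifold of `N`: near each of its points, it is the zero set of a
submersion to some `ℝᵐ`. -/
def IsEmbeddedSubmanifold (S : Set N) : Prop :=
  ∀ p ∈ S, ∃ (O : Set N) (m : ℕ) (f : N → EuclideanSpace ℝ (Fin m)),
    IsOpen O ∧ p ∈ O ∧ ContMDiffOn J 𝓘(ℝ, EuclideanSpace ℝ (Fin m)) ∞ f O ∧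
    S ∩ O = {x ∈ O | f x = 0} ∧
    ∀ x ∈ S ∩ O, Function.Surjective (mfderiv J 𝓘(ℝ, EuclideanSpace ℝ (Fin m)) f x)

/-- The tangent space at `p` of an embedded submanifold `S` of `N`, as a subspace of `T_p N`:
the vectors that annihilate every smooth function defined near `p` and vanishing on `S`. -/
def tangentSubspace (S : Set N) (p : N) : Submodule ℝ (TangentSpace J p) where
  carrier := {X | ∀ (O : Set N) (f : N → ℝ), IsOpen O → p ∈ O →
    ContMDiffOn J 𝓘(ℝ, ℝ) ∞ f O → (∀ x ∈ S ∩ O, f x = 0) → differential J f p X = 0}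
  zero_mem' := fun _ _ _ _ _ _ => map_zero _
  add_mem' := fun hX hY O f h₁ h₂ h₃ h₄ => by
    rw [map_add, hX O f h₁ h₂ h₃ h₄, hY O f h₁ h₂ h₃ h₄, add_zero]
  smul_mem' := fun c X hX O f h₁ h₂ h₃ h₄ => by
    rw [map_smul, hX O f h₁ h₂ h₃ h₄, smul_zero]

end Submanifolds

variable {E : Type*} [NormedAddCommGroup E] [NormedSpace ℝ E]
  {Q : Type*} [TopologicalSpace Q] [ChartedSpace E Q] [IsManifold 𝓘(ℝ, E) ∞ Q]

/-! ### Vertical vectors and the vertical lift on `TQ` -/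

/-- The inclusion of the fibre `T_q Q` in `TQ`. -/
def fibreIncl (q : Q) (w : E) : TQ E Q := ⟨q, w⟩

theorem hasMFDerivAt_proj (v : TQ E Q) :
    HasMFDerivAt (modelTQ E) 𝓘(ℝ, E) (TotalSpace.proj : TQ E Q → Q) v
      (ContinuousLinearMap.fst ℝ E E) := by
  refine ⟨(FiberBundle.continuous_proj E (TangentSpace 𝓘(ℝ, E))).continuousAt, ?_⟩
  have h : HasFDerivWithinAt (Prod.fst : E × E → E) (ContinuousLinearMap.fst ℝ E E)
    (range (modelTQ E)) (extChartAt (modelTQ E) v v) := hasFDerivAt_fst.hasFDerivWithinAt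
  have key : ∀ z ∈ (extChartAt (modelTQ E) v).target,
      writtenInExtChartAt (modelTQ E) 𝓘(ℝ, E) v (TotalSpace.proj : TQ E Q → Q) z = z.1 := by
    intro z hz
    have hz' : z ∈ (chartAt (ModelProd E E) v).target := by
      rw [extChartAt_target] at hz
      exact hz.1
    have h1 : z.1 ∈ (chartAt E v.proj).target := (TangentBundle.mem_chart_target_iff z v).1 hz'
    have h2 := TangentBundle.coe_chartAt_symm_fst (I := 𝓘(ℝ, E)) z v
    change (chartAt E v.proj) ((chartAt (ModelProd E E) v).symm z).proj = z.1
    rw [h2, (chartAt E v.proj).right_inv h1]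
  refine h.congr_of_eventuallyEq ?_ ?_
  · filter_upwards [extChartAt_target_mem_nhdsWithin (I := modelTQ E) v] with z hz
    exact key z hz
  · exact key _ (mem_extChartAt_target v)

theorem hasMFDerivAt_fibreIncl (q : Q) (w : E) :
    HasMFDerivAt 𝓘(ℝ, E) (modelTQ E) (fibreIncl (E := E) q) w
      (ContinuousLinearMap.inr ℝ E E) := by
  have hc : Continuous (fibreIncl (E := E) q) :=
    (FiberBundle.totalSpaceMk_isInducing E (TangentSpace 𝓘(ℝ, E)) q).continuous
  refine ⟨hc.continuousAt, ?_⟩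
  have h : HasFDerivWithinAt (fun u : E => ((chartAt E q q, u) : E × E))
    (ContinuousLinearMap.inr ℝ E E) (range 𝓘(ℝ, E)) (extChartAt 𝓘(ℝ, E) w w) :=
      (hasFDerivAt_prodMk_right _ _).hasFDerivWithinAt
  have key : ∀ u : E, writtenInExtChartAt 𝓘(ℝ, E) (modelTQ E) w (fibreIncl (E := E) q) u =
      ((chartAt E q q, u) : E × E) := by
    intro u
    change (chartAt (ModelProd E E) (fibreIncl (E := E) q w)) (fibreIncl (E := E) q u) = _
    refine Prod.ext (TangentBundle.coe_chartAt_fst (I := 𝓘(ℝ, E)) _ _) ?_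
    exact tangentCoordChange_self (I := 𝓘(ℝ, E)) (x := q) (z := q) (v := u)
      (mem_extChartAt_source q)
  exact h.congr_of_eventuallyEq (Filter.Eventually.of_forall key) (key _)

/-- The vertical tangent space `V_v(TQ)`: the kernel of the tangent map of `TQ → Q` at `v`. -/
def verticalSpace (v : TQ E Q) : Submodule ℝ (TangentSpace (modelTQ E) v) :=
  (mfderiv (modelTQ E) 𝓘(ℝ, E) (TotalSpace.proj : TQ E Q → Q) v).ker

/-- The tangent map at `w` of the inclusion of the fibre `T_q Q` in `TQ`. -/
def fibreInclDeriv (q : Q) (w : E) : E →L[ℝ] TangentSpace (modelTQ E) (fibreIncl q w) :=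
  mfderiv 𝓘(ℝ, E) (modelTQ E) (fibreIncl (E := E) q) w

theorem fibreInclDeriv_apply (q : Q) (w u : E) :
    (fibreInclDeriv q w u : E × E) = (0, u) := by
  rw [fibreInclDeriv, (hasMFDerivAt_fibreIncl q w).mfderiv]
  rfl

theorem mem_verticalSpace (v : TQ E Q) (X : TangentSpace (modelTQ E) v) :
    X ∈ verticalSpace v ↔ (X : E × E).1 = 0 := by
  rw [verticalSpace, LinearMap.mem_ker, (hasMFDerivAt_proj v).mfderiv]
  rfl

/-- The vertical lift `T_q Q ≃ V_v(TQ)` at `v ∈ T_q Q`: the tangent map at `v` of the inclusion of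
the fibre `T_q Q` in `TQ`; that is, `w` is sent to the velocity at `t = 0` of `v + t w`. -/
def verticalLift (v : TQ E Q) : TangentSpace 𝓘(ℝ, E) v.proj ≃ₗ[ℝ] verticalSpace v :=
  LinearEquiv.ofBijective
    (LinearMap.codRestrict (verticalSpace v) (fibreInclDeriv (E := E) v.proj v.2).toLinearMap
      (fun w => (mem_verticalSpace v _).2
        (congrArg Prod.fst (fibreInclDeriv_apply (E := E) v.proj v.2 w))))
    (by
      constructor
      · intro w w' h
        have h' : (fibreInclDeriv (E := E) v.proj v.2 w : E × E) = fibreInclDeriv (E := E) v.proj v.2 w' :=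
          congrArg Subtype.val h
        have h'' : ((0, w) : E × E) = (0, w') :=
          (fibreInclDeriv_apply (E := E) v.proj v.2 w).symm.trans
            (h'.trans (fibreInclDeriv_apply (E := E) v.proj v.2 w'))
        exact congrArg Prod.snd h''
      · rintro ⟨X, hX⟩
        rw [mem_verticalSpace] at hX
        refine ⟨(X : E × E).2, Subtype.ext ?_⟩
        exact (fibreInclDeriv_apply (E := E) v.proj v.2 (X : E × E).2).trans (Prod.ext hX.symm rfl))

/-- The section `α^v` of `V*(TQ)` given by a covector `α ∈ T*_q Q` at `v ∈ T_q Q`. -/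
def verticalCovector (v : TQ E Q) (α : TangentSpace 𝓘(ℝ, E) v.proj →L[ℝ] ℝ) :
    Module.Dual ℝ (verticalSpace v) :=
  α.toLinearMap ∘ₗ (verticalLift v).symm.toLinearMap

/-! ### Fibre derivatives -/

/-- The fibre derivative `Df : TQ → T*Q` of a function `f` on `TQ`. -/
def fibreDeriv (f : TQ E Q → ℝ) (v : TQ E Q) : TangentSpace 𝓘(ℝ, E) v.proj →L[ℝ] ℝ :=
  (fderiv ℝ (fun w : E => f ⟨v.proj, w⟩) v.2 : E →L[ℝ] ℝ)

/-- The Legendre map `DL : TQ → T*Q`. -/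
def legendre (L : TQ E Q → ℝ) (v : TQ E Q) : CoTQ E Q := ⟨v.proj, fibreDeriv L v⟩

/-- The energy of `L`, `v ↦ ⟨DL(v), v⟩ - L(v)`. -/
def energy (L : TQ E Q → ℝ) (v : TQ E Q) : ℝ := fibreDeriv L v v.2 - L v

/-- The canonical isomorphism of a finite-dimensional space with its bidual. -/
def bidualEquiv [FiniteDimensional ℝ E] : E ≃ₗ[ℝ] ((E →L[ℝ] ℝ) →L[ℝ] ℝ) :=
  LinearEquiv.ofBijective (NormedSpace.inclusionInDoubleDual ℝ E).toLinearMap (by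
    have hinj : Function.Injective (NormedSpace.inclusionInDoubleDual ℝ E).toLinearMap :=
      (NormedSpace.inclusionInDoubleDualLi (E := E) ℝ).injective
    have h1 : ∀ (V : Type _) [NormedAddCommGroup V] [NormedSpace ℝ V] [FiniteDimensional ℝ V],
        Module.finrank ℝ (V →L[ℝ] ℝ) = Module.finrank ℝ V := fun V _ _ _ =>
      (LinearMap.toContinuousLinearMap (𝕜 := ℝ) (E := V) (F' := ℝ)).finrank_eq.symm.trans
        Subspace.dual_finrank_eq
    exact ⟨hinj, (LinearMap.injective_iff_surjective_of_finrank_eq_finrank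
      (by rw [h1, h1])).1 hinj⟩)

/-- The fibre derivative of a function `h` on `T*Q`, as a map `T*Q → T**Q ≃ TQ`. -/
def coFibreDeriv [FiniteDimensional ℝ E] (h : CoTQ E Q → ℝ) (p : CoTQ E Q) :
    TangentSpace 𝓘(ℝ, E) p.proj :=
  (bidualEquiv (E := E)).symm (fderiv ℝ (fun β : E →L[ℝ] ℝ => h ⟨p.proj, β⟩) p.2)

/-- The fibre hessian of a function `h` on `T*Q`, as a map `T*Q → Hom(T*Q, TQ)`. -/
def coFibreHessian [FiniteDimensional ℝ E] (h : CoTQ E Q → ℝ) (p : CoTQ E Q) :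
    (TangentSpace 𝓘(ℝ, E) p.proj →L[ℝ] ℝ) →L[ℝ] TangentSpace 𝓘(ℝ, E) p.proj :=
  (fderiv ℝ (fun β : E →L[ℝ] ℝ => (coFibreDeriv h ⟨p.proj, β⟩ : E)) p.2 :
    (E →L[ℝ] ℝ) →L[ℝ] E)

/-- The map `γ_h = Dh ∘ DL : TQ → TQ`. -/
def gam [FiniteDimensional ℝ E] (L : TQ E Q → ℝ) (h : CoTQ E Q → ℝ) (v : TQ E Q) :
    TangentSpace 𝓘(ℝ, E) v.proj :=
  coFibreDeriv h (legendre L v)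

/-- The vertical vector field `Γ_h = γ_h^v` on `TQ`. -/
def Gam [FiniteDimensional ℝ E] (L : TQ E Q → ℝ) (h : CoTQ E Q → ℝ) (v : TQ E Q) :
    verticalSpace v :=
  verticalLift v (gam L h v)

/-! ### Almost regular lagrangians, hamiltonians and primary hamiltonian constraints -/

/-- `L` is almost regular: its Legendre map is a submersion onto a closed submanifold of `T*Q`,
with connected fibres. -/
structure AlmostRegular (L : TQ E Q → ℝ) : Prop where
  isClosed : IsClosed (range (legendre L))
  submanifold : IsEmbeddedSubmanifold (modelCoTQ E) (range (legendre L))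
  submersion : ∀ v, (mfderiv (modelTQ E) (modelCoTQ E) (legendre L) v).range =
    tangentSubspace (modelCoTQ E) (range (legendre L)) (legendre L v)
  connected : ∀ p ∈ range (legendre L), IsConnected (legendre L ⁻¹' {p})

/-- `H` is a hamiltonian for `L` on the open set `O` of `T*Q`: `H ∘ DL` is the energy. -/
structure IsHamiltonian (L : TQ E Q → ℝ) (O : Set (CoTQ E Q)) (H : CoTQ E Q → ℝ) : Prop where
  smooth : ContMDiffOn (modelCoTQ E) 𝓘(ℝ, ℝ) ∞ H O
  energy_eq : ∀ v, legendre L v ∈ O → energy L v = H (legendre L v)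

/-- The functions `φ μ` are an independent set of primary hamiltonian constraints on the open set
`O` of `T*Q`: their vanishing defines the image of the Legendre map in `O`, and their differentials
are linearly independent at its points. -/
structure IsIndependentPrimaryConstraints {ι : Type*} (L : TQ E Q → ℝ) (O : Set (CoTQ E Q))
    (φ : ι → CoTQ E Q → ℝ) : Prop where
  smooth : ∀ μ, ContMDiffOn (modelCoTQ E) 𝓘(ℝ, ℝ) ∞ (φ μ) O
  defines : range (legendre L) ∩ O = {p ∈ O | ∀ μ, φ μ p = 0}
  independent : ∀ p ∈ range (legendre L) ∩ O,
    LinearIndependent ℝ (fun μ => differential (modelCoTQ E) (φ μ) p)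

/-- The functions `lam μ` on the open set `U` of `TQ` resolve the identity of `TQ`:
`Id = γ_H + ∑ μ, lam μ γ_μ` on `U`. -/
structure IsResolution [FiniteDimensional ℝ E] {ι : Type*} [Fintype ι] (L : TQ E Q → ℝ)
    (H : CoTQ E Q → ℝ) (φ : ι → CoTQ E Q → ℝ) (U : Set (TQ E Q)) (lam : ι → TQ E Q → ℝ) :
    Prop where
  smooth : ∀ μ, ContMDiffOn (modelTQ E) 𝓘(ℝ, ℝ) ∞ (lam μ) U
  eq : ∀ v ∈ U, v.2 = gam L H v + ∑ μ, lam μ v • gam L (φ μ) v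

/-- The map `M = D²H ∘ DL + ∑ μ, lam μ (D²φ_μ ∘ DL)`, from `TQ` to `Hom(T*Q, TQ)`. -/
def M [FiniteDimensional ℝ E] {ι : Type*} [Fintype ι] (L : TQ E Q → ℝ)
    (H : CoTQ E Q → ℝ) (φ : ι → CoTQ E Q → ℝ) (lam : ι → TQ E Q → ℝ) (v : TQ E Q) :
    (TangentSpace 𝓘(ℝ, E) v.proj →L[ℝ] ℝ) →L[ℝ] TangentSpace 𝓘(ℝ, E) v.proj :=
  coFibreHessian H (legendre L v) + ∑ μ, lam μ v • coFibreHessian (φ μ) (legendre L v)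

/-- The operator `V*(TQ) → V(TQ)` corresponding to `M`. -/
def Mhat [FiniteDimensional ℝ E] {ι : Type*} [Fintype ι] (L : TQ E Q → ℝ)
    (H : CoTQ E Q → ℝ) (φ : ι → CoTQ E Q → ℝ) (lam : ι → TQ E Q → ℝ) (v : TQ E Q)
    (ξ : Module.Dual ℝ (verticalSpace v)) : verticalSpace v :=
  let α : E →ₗ[ℝ] ℝ := ξ ∘ₗ (verticalLift v).toLinearMap
  let α' : E →L[ℝ] ℝ := LinearMap.toContinuousLinearMap α
  verticalLift v (M L H φ lam v α')

/-! ### The Euler-Lagrange form and second-order vector fields -/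

/-- The set `N_v(TQ)` of the tangent vectors at `v ∈ TQ` that satisfy the second-order condition
`T(π) X = v`, where `π : TQ → Q`. -/
def secondOrderVectors (v : TQ E Q) : Set (TangentSpace (modelTQ E) v) :=
  {X | mfderiv (modelTQ E) 𝓘(ℝ, E) (TotalSpace.proj : TQ E Q → Q) v X = v.2}

/-- The local expression of `L` in the chart of `TQ` induced by the chart of `Q` at the base point
of `v`. -/
def localLagrangian (L : TQ E Q → ℝ) (v : TQ E Q) (z : E × E) : ℝ :=
  L ((extChartAt (modelTQ E) v).symm z)

/-- The Euler-Lagrange form on a second-order tangent vector `X` at `v ∈ T_q Q`. In the natural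
coordinates `(x, u)` of `TQ` induced by the chart of `Q` at `q`, it is
`(∂L/∂xⁱ - X(∂L/∂uⁱ)) dxⁱ`. -/
def eulerLagrange (L : TQ E Q → ℝ) (v : TQ E Q) (X : TangentSpace (modelTQ E) v) :
    TangentSpace 𝓘(ℝ, E) v.proj →L[ℝ] ℝ :=
  let z : E × E := extChartAt (modelTQ E) v v
  let X' : E × E := mfderiv (modelTQ E) 𝓘(ℝ, E × E) (extChartAt (modelTQ E) v) v X
  let dx : TangentSpace 𝓘(ℝ, E) v.proj →L[ℝ] E :=
    mfderiv 𝓘(ℝ, E) 𝓘(ℝ, E) (extChartAt 𝓘(ℝ, E) v.proj) v.proj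
  ((fderiv ℝ (localLagrangian L v) z).comp (ContinuousLinearMap.inl ℝ E E) -
    fderiv ℝ (fun y : E × E =>
      (fderiv ℝ (localLagrangian L v) y).comp (ContinuousLinearMap.inr ℝ E E)) z X').comp dx

/-- The Euler-Lagrange form as a map `N(TQ) → V*(TQ)`. -/
def eulerLagrangeHat (L : TQ E Q → ℝ) (v : TQ E Q) (X : TangentSpace (modelTQ E) v) :
    Module.Dual ℝ (verticalSpace v) :=
  verticalCovector v (eulerLagrange L v X)

/-- `X` is a (smooth) second-order vector field on the open set `U` of `TQ`. -/
structure IsSecondOrderField (U : Set (TQ E Q)) (X : ∀ v : TQ E Q, TangentSpace (modelTQ E) v) :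
    Prop where
  smooth : ContMDiffOn (modelTQ E) (modelTQ E).tangent ∞
    (fun v => (⟨v, X v⟩ : TangentBundle (modelTQ E) (TQ E Q))) U
  secondOrder : ∀ v ∈ U, X v ∈ secondOrderVectors v

/-- The primary lagrangian constraint subset `V₁` of `TQ`: the points at which the Euler-Lagrange
form vanishes on some second-order tangent vector. -/
def primaryLagrangianSubset (L : TQ E Q → ℝ) : Set (TQ E Q) :=
  {v | ∃ X ∈ secondOrderVectors v, eulerLagrangeHat L v X = 0}

/-- `X` is a primary dynamical field of `L` on the open set `U` of `TQ`: a second-order vector field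
satisfying the Euler-Lagrange equation on `V₁`. -/
structure IsPrimaryField (L : TQ E Q → ℝ) (U : Set (TQ E Q))
    (X : ∀ v : TQ E Q, TangentSpace (modelTQ E) v) : Prop where
  field : IsSecondOrderField U X
  eulerLagrange_eq : ∀ v ∈ primaryLagrangianSubset L ∩ U, eulerLagrangeHat L v (X v) = 0

/-- The primary lagrangian constraint `⟨δL ∘ X₀, Γ_φ⟩` given by a second-order vector field `X₀` and
a primary hamiltonian constraint `φ`. -/
def chi [FiniteDimensional ℝ E] (L : TQ E Q → ℝ) (φ : CoTQ E Q → ℝ)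
    (X₀ : ∀ v : TQ E Q, TangentSpace (modelTQ E) v) (v : TQ E Q) : ℝ :=
  eulerLagrangeHat L v (X₀ v) (Gam L φ v)

/-- The vector field `D₀ = X₀ + M ∘ (δL ∘ X₀)`. -/
def D₀ [FiniteDimensional ℝ E] {ι : Type*} [Fintype ι] (L : TQ E Q → ℝ)
    (H : CoTQ E Q → ℝ) (φ : ι → CoTQ E Q → ℝ) (lam : ι → TQ E Q → ℝ)
    (X₀ : ∀ v : TQ E Q, TangentSpace (modelTQ E) v) (v : TQ E Q) : TangentSpace (modelTQ E) v :=
  X₀ v + (Mhat L H φ lam v (eulerLagrangeHat L v (X₀ v)) : TangentSpace (modelTQ E) v)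

end

end SingularLagrangian

open SingularLagrangian

/-!
On a fibre, `H ∘ DL = E` and `φ_μ ∘ DL = 0` differentiate to `D²L(v - γ_H(v)) = 0` and
`D²L(γ_μ) = 0`. The submersion property makes every covector annihilated by the `γ_μ` belong to the
image of `D²L`, so the `γ_μ` span the kernel of `D²L`; they are independent, whence the functions
`λ_μ` and their smoothness. Differentiating `(*)` along the fibres and transposing gives
`Id - D²L ∘ M = ∑ μ, Dλ_μ ⊗ γ_μ`; since adding a vertical vector `u` changes `δL` by `-D²L(u)`, this
is the formula for `δL ∘ D₀`. Finally, at a point of `V₁` the covector `δL(X₀)` lies in the image of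
the symmetric form `D²L`, and therefore annihilates its kernel: `χ_μ = 0`.
-/

namespace SingularLagrangian

noncomputable section

variable {E : Type*} [NormedAddCommGroup E] [NormedSpace ℝ E]

-- Without these shortcuts, instance synthesis on the bidual times out.
local instance instNormedAddCommGroupBidual : NormedAddCommGroup ((E →L[ℝ] ℝ) →L[ℝ] ℝ) :=
  ContinuousLinearMap.toNormedAddCommGroup

local instance instNormedSpaceBidual : NormedSpace ℝ ((E →L[ℝ] ℝ) →L[ℝ] ℝ) :=
  ContinuousLinearMap.toNormedSpace

/-! ### Gradients of functions on a dual space -/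

section DualGradient

variable [FiniteDimensional ℝ E]

/-- The canonical isomorphism `E ≃ E**` as a continuous linear equivalence, which carries smoothness
from `E**` to `E`. -/
def bidualContinuousEquiv : E ≃L[ℝ] ((E →L[ℝ] ℝ) →L[ℝ] ℝ) :=
  (bidualEquiv (E := E)).toContinuousLinearEquiv

/-- The gradient of a function on the dual of `E`, as a vector of `E`: the fibre derivative
`coFibreDeriv` on a single fibre. -/
def dualGradient (k : (E →L[ℝ] ℝ) → ℝ) (β : E →L[ℝ] ℝ) : E :=
  (bidualEquiv (E := E)).symm (fderiv ℝ k β)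

theorem apply_bidualEquiv_symm (ψ : (E →L[ℝ] ℝ) →L[ℝ] ℝ) (α : E →L[ℝ] ℝ) :
    α ((bidualEquiv (E := E)).symm ψ) = ψ α :=
  DFunLike.congr_fun ((bidualEquiv (E := E)).apply_symm_apply ψ) α

theorem apply_dualGradient (k : (E →L[ℝ] ℝ) → ℝ) (α β : E →L[ℝ] ℝ) :
    α (dualGradient k β) = fderiv ℝ k β α :=
  apply_bidualEquiv_symm _ α

theorem eq_dualGradient_iff {k : (E →L[ℝ] ℝ) → ℝ} {β : E →L[ℝ] ℝ} {u : E} :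
    u = dualGradient k β ↔ ∀ α : E →L[ℝ] ℝ, α u = fderiv ℝ k β α := by
  rw [SeparatingDual.eq_iff_forall_dual_eq (R := ℝ)]
  exact forall_congr' fun α => by rw [apply_dualGradient k α β]

section Parametrized

variable {F : Type*} [NormedAddCommGroup F] [NormedSpace ℝ F] {K : F → (E →L[ℝ] ℝ) → ℝ}
  {g : F → E →L[ℝ] ℝ} {x : F} {m n : WithTop ℕ∞}

theorem contDiffAt_dualGradient (hK : ContDiffAt ℝ n (Function.uncurry K) (x, g x))
    (hg : ContDiffAt ℝ m g x) (hmn : m + 1 ≤ n) :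
    ContDiffAt ℝ m (fun y => dualGradient (K y) (g y)) x :=
  (bidualContinuousEquiv (E := E)).symm.contDiff.contDiffAt.comp x (hK.fderiv hg hmn)

theorem contDiffAt_fderiv_dualGradient (hK : ContDiffAt ℝ n (Function.uncurry K) (x, g x))
    (hg : ContDiffAt ℝ m g x) (hmn : m + 1 + 1 ≤ n) :
    ContDiffAt ℝ m (fun y => fderiv ℝ (dualGradient (K y)) (g y)) x := by
  refine ContDiffAt.fderiv (f := fun y => dualGradient (K y)) (n := m + 1) ?_ hg le_rfl
  exact contDiffAt_dualGradient (K := fun z : F × (E →L[ℝ] ℝ) => K z.1) (g := Prod.snd)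
    (ContDiffAt.comp (g := Function.uncurry K) ((x, g x), g x) hK
      (contDiffAt_fst.fst.prodMk contDiffAt_snd)) contDiffAt_snd hmn

end Parametrized

variable {k : (E →L[ℝ] ℝ) → ℝ} {β : E →L[ℝ] ℝ}

theorem differentiableAt_dualGradient (hk : ContDiffAt ℝ 2 k β) :
    DifferentiableAt ℝ (dualGradient k) β :=
  (contDiffAt_dualGradient (K := fun _ : E →L[ℝ] ℝ => k) (g := id) (m := 1)
    (hk.comp (β, β) contDiffAt_snd) contDiffAt_id le_rfl).differentiableAt one_ne_zero

theorem apply_fderiv_dualGradient (hk : ContDiffAt ℝ 2 k β) (α α' : E →L[ℝ] ℝ) :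
    α' (fderiv ℝ (dualGradient k) β α) = fderiv ℝ (fderiv ℝ k) β α α' := by
  have h : DifferentiableAt ℝ (fderiv ℝ k) β :=
    (hk.fderiv_right (m := 1) le_rfl).differentiableAt one_ne_zero
  have hd : fderiv ℝ (dualGradient k) β =
      ((bidualContinuousEquiv (E := E)).symm : _ →L[ℝ] E).comp (fderiv ℝ (fderiv ℝ k) β) :=
    ((bidualContinuousEquiv (E := E)).symm.hasFDerivAt.comp β h.hasFDerivAt).fderiv
  rw [hd]
  exact apply_bidualEquiv_symm _ α'

theorem apply_fderiv_dualGradient_comm (hk : ContDiffAt ℝ 2 k β) (α α' : E →L[ℝ] ℝ) :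
    α' (fderiv ℝ (dualGradient k) β α) = α (fderiv ℝ (dualGradient k) β α') := by
  rw [apply_fderiv_dualGradient hk, apply_fderiv_dualGradient hk]
  exact (hk.isSymmSndFDerivAt (by simp)).eq α α'

section Precomp

variable {E' : Type*} [NormedAddCommGroup E'] [NormedSpace ℝ E'] [FiniteDimensional ℝ E']
  {A : E →L[ℝ] E'} {β' : E' →L[ℝ] ℝ}

theorem dualGradient_precomp (hk : DifferentiableAt ℝ k (β'.comp A)) :
    dualGradient (fun η : E' →L[ℝ] ℝ => k (η.comp A)) β' = A (dualGradient k (β'.comp A)) := by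
  refine (eq_dualGradient_iff.2 fun α => ?_).symm
  have h := (hk.hasFDerivAt.comp β' (ContinuousLinearMap.precomp ℝ A).hasFDerivAt).fderiv
  exact (apply_dualGradient k (α.comp A) _).trans (DFunLike.congr_fun h α).symm

theorem fderiv_dualGradient_precomp (hk : ContDiffAt ℝ 2 k (β'.comp A)) (α : E' →L[ℝ] ℝ) :
    fderiv ℝ (dualGradient fun η : E' →L[ℝ] ℝ => k (η.comp A)) β' α =
      A (fderiv ℝ (dualGradient k) (β'.comp A) (α.comp A)) := by
  have hA := (ContinuousLinearMap.precomp (𝕜₃ := ℝ) ℝ A).hasFDerivAt (x := β')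
  have h : (dualGradient fun η : E' →L[ℝ] ℝ => k (η.comp A)) =ᶠ[𝓝 β']
      fun η => A (dualGradient k (η.comp A)) :=
    (hA.continuousAt.eventually (hk.eventually (by simp))).mono fun η hη =>
      dualGradient_precomp (hη.differentiableAt two_ne_zero)
  rw [h.fderiv_eq]
  exact DFunLike.congr_fun
    (A.hasFDerivAt.comp β' ((differentiableAt_dualGradient hk).hasFDerivAt.comp β' hA)).fderiv α

end Precomp

end DualGradient

/-! ### Hamiltonian identities on a single fibre -/

section FibreIdentities

variable [FiniteDimensional ℝ E] {ℓ : E → ℝ} {k : (E →L[ℝ] ℝ) → ℝ} {w : E}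

theorem fderiv_comp_fderiv_apply (hℓ : DifferentiableAt ℝ (fderiv ℝ ℓ) w)
    (hk : DifferentiableAt ℝ k (fderiv ℝ ℓ w)) (u : E) :
    fderiv ℝ (fun w' => k (fderiv ℝ ℓ w')) w u =
      fderiv ℝ (fderiv ℝ ℓ) w u (dualGradient k (fderiv ℝ ℓ w)) := by
  rw [apply_dualGradient]
  exact DFunLike.congr_fun (hk.hasFDerivAt.comp w hℓ.hasFDerivAt).fderiv u

theorem hessian_apply_dualGradient_eq_zero (hℓ : DifferentiableAt ℝ (fderiv ℝ ℓ) w)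
    (hk : DifferentiableAt ℝ k (fderiv ℝ ℓ w)) (h : ∀ᶠ w' in 𝓝 w, k (fderiv ℝ ℓ w') = 0) (u : E) :
    fderiv ℝ (fderiv ℝ ℓ) w u (dualGradient k (fderiv ℝ ℓ w)) = 0 := by
  have hconst : fderiv ℝ (fun w' => k (fderiv ℝ ℓ w')) w = 0 :=
    Filter.EventuallyEq.fderiv_eq h |>.trans (fderiv_const_apply 0)
  rw [← fderiv_comp_fderiv_apply hℓ hk, hconst]
  rfl

theorem hessian_apply_sub_dualGradient_eq_zero (hℓ : ContDiffAt ℝ 2 ℓ w)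
    (hk : DifferentiableAt ℝ k (fderiv ℝ ℓ w))
    (h : ∀ᶠ w' in 𝓝 w, fderiv ℝ ℓ w' w' - ℓ w' = k (fderiv ℝ ℓ w')) (u : E) :
    fderiv ℝ (fderiv ℝ ℓ) w u (w - dualGradient k (fderiv ℝ ℓ w)) = 0 := by
  have hℓ₁ : DifferentiableAt ℝ ℓ w := hℓ.differentiableAt two_ne_zero
  have hℓ₂ : DifferentiableAt ℝ (fderiv ℝ ℓ) w :=
    (hℓ.fderiv_right (m := 1) le_rfl).differentiableAt one_ne_zero
  have henergy : fderiv ℝ (fun w' => fderiv ℝ ℓ w' w' - ℓ w') w u =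
      fderiv ℝ (fderiv ℝ ℓ) w u w := by
    have hd := ((hℓ₂.hasFDerivAt.clm_apply (hasFDerivAt_id w)).sub hℓ₁.hasFDerivAt).fderiv
    refine (DFunLike.congr_fun hd u).trans ?_
    simp
  rw [map_sub, ← henergy, Filter.EventuallyEq.fderiv_eq h,
    fderiv_comp_fderiv_apply hℓ₂ hk, sub_self]

variable {ι : Type*} [Fintype ι] {φ : ι → (E →L[ℝ] ℝ) → ℝ} {c : ι → E → ℝ}

theorem eq_add_sum_fderiv_smul_dualGradient (hℓ : DifferentiableAt ℝ (fderiv ℝ ℓ) w)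
    (hk : ContDiffAt ℝ 2 k (fderiv ℝ ℓ w)) (hφ : ∀ μ, ContDiffAt ℝ 2 (φ μ) (fderiv ℝ ℓ w))
    (hc : ∀ μ, DifferentiableAt ℝ (c μ) w)
    (h : ∀ᶠ w' in 𝓝 w, w' = dualGradient k (fderiv ℝ ℓ w') +
      ∑ μ, c μ w' • dualGradient (φ μ) (fderiv ℝ ℓ w')) (u : E) :
    u = (fderiv ℝ (dualGradient k) (fderiv ℝ ℓ w) +
        ∑ μ, c μ w • fderiv ℝ (dualGradient (φ μ)) (fderiv ℝ ℓ w)) (fderiv ℝ (fderiv ℝ ℓ) w u) +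
      ∑ μ, fderiv ℝ (c μ) w u • dualGradient (φ μ) (fderiv ℝ ℓ w) := by
  have hgrad : ∀ {k' : (E →L[ℝ] ℝ) → ℝ}, ContDiffAt ℝ 2 k' (fderiv ℝ ℓ w) →
      HasFDerivAt (fun w' => dualGradient k' (fderiv ℝ ℓ w'))
        ((fderiv ℝ (dualGradient k') (fderiv ℝ ℓ w)).comp (fderiv ℝ (fderiv ℝ ℓ) w)) w := fun hk' =>
    (differentiableAt_dualGradient hk').hasFDerivAt.comp w hℓ.hasFDerivAt
  have hd := (hgrad hk).add (HasFDerivAt.fun_sum (u := Finset.univ)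
    fun μ _ => (hc μ).hasFDerivAt.smul (hgrad (hφ μ)))
  refine (DFunLike.congr_fun ((hasFDerivAt_id w).unique (hd.congr_of_eventuallyEq h)) u).trans ?_
  simp only [add_apply, sum_apply, smul_apply, ContinuousLinearMap.comp_apply,
    ContinuousLinearMap.smulRight_apply, Finset.sum_add_distrib, add_assoc]

/-- The transpose of the previous identity `Id = N ∘ D²ℓ + ∑ μ, Dc_μ ⊗ γ_μ`, both `N` and `D²ℓ`
being symmetric. -/
theorem sub_hessian_apply_eq_sum (hℓ : ContDiffAt ℝ 2 ℓ w) (hk : ContDiffAt ℝ 2 k (fderiv ℝ ℓ w))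
    (hφ : ∀ μ, ContDiffAt ℝ 2 (φ μ) (fderiv ℝ ℓ w)) (hc : ∀ μ, DifferentiableAt ℝ (c μ) w)
    (h : ∀ᶠ w' in 𝓝 w, w' = dualGradient k (fderiv ℝ ℓ w') +
      ∑ μ, c μ w' • dualGradient (φ μ) (fderiv ℝ ℓ w')) (α : E →L[ℝ] ℝ) :
    α - fderiv ℝ (fderiv ℝ ℓ) w ((fderiv ℝ (dualGradient k) (fderiv ℝ ℓ w) +
        ∑ μ, c μ w • fderiv ℝ (dualGradient (φ μ)) (fderiv ℝ ℓ w)) α) =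
      ∑ μ, α (dualGradient (φ μ) (fderiv ℝ ℓ w)) • fderiv ℝ (c μ) w := by
  have hderiv := eq_add_sum_fderiv_smul_dualGradient
    ((hℓ.fderiv_right (m := 1) le_rfl).differentiableAt one_ne_zero) hk hφ hc h
  set N := fderiv ℝ (dualGradient k) (fderiv ℝ ℓ w) +
    ∑ μ, c μ w • fderiv ℝ (dualGradient (φ μ)) (fderiv ℝ ℓ w) with hN
  have hN_symm : ∀ β, β (N α) = α (N β) := fun β => by
    simp only [hN, add_apply, sum_apply, smul_apply, map_add, map_sum, map_smul,
      apply_fderiv_dualGradient_comm hk α β, fun μ => apply_fderiv_dualGradient_comm (hφ μ) α β]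
  ext u
  have hα : α u = α (N (fderiv ℝ (fderiv ℝ ℓ) w u)) +
      ∑ μ, fderiv ℝ (c μ) w u * α (dualGradient (φ μ) (fderiv ℝ ℓ w)) := by
    conv_lhs => rw [hderiv u]
    simp only [map_add, map_sum, map_smul, smul_eq_mul]
  have hℓ_symm : fderiv ℝ (fderiv ℝ ℓ) w (N α) u = fderiv ℝ (fderiv ℝ ℓ) w u (N α) :=
    (hℓ.isSymmSndFDerivAt (by simp)).eq _ _
  simp only [sub_apply, sum_apply, smul_apply, smul_eq_mul, hℓ_symm, hN_symm, hα,
    add_sub_cancel_left, mul_comm]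

end FibreIdentities

/-! ### Spans and coefficients with respect to an independent family -/

section LinearAlgebra

theorem linearIndependent_of_apply_inr_eq {F D G ι : Type*} [NormedAddCommGroup F]
    [NormedSpace ℝ F] [NormedAddCommGroup D] [NormedSpace ℝ D] [Finite ι] {η : ι → F × D →L[ℝ] ℝ}
    {γ : ι → F} {T : G → F × D} {B : D → F →L[ℝ] ℝ} (hi : LinearIndependent ℝ η)
    (hT : ∀ x, ∃ X, (T X).1 = x) (himage : ∀ μ X, η μ (T X) = 0)
    (hvert : ∀ μ α, η μ (0, α) = B α (γ μ)) : LinearIndependent ℝ γ := by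
  have := Fintype.ofFinite ι
  rw [Fintype.linearIndependent_iff] at hi ⊢
  intro c hc
  refine hi c (ContinuousLinearMap.ext fun Y => ?_)
  obtain ⟨X, hX⟩ := hT Y.1
  have hY : Y = T X + (0, Y.2 - (T X).2) := Prod.ext (by simp [hX]) (by simp)
  have hη : ∀ μ, η μ Y = B (Y.2 - (T X).2) (γ μ) := fun μ => by
    conv_lhs => rw [hY, map_add, himage, hvert, zero_add]
  simp only [sum_apply, smul_apply, hη, ← map_smul, ← map_sum, hc, map_zero, zero_apply]

variable {G : Type*} [NormedAddCommGroup G] [NormedSpace ℝ G] [FiniteDimensional ℝ G]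
  {ι : Type*}

theorem mem_span_range_of_forall_mem_range {V : Type*} {B : V → G →L[ℝ] ℝ}
    {γ : ι → G} (h : ∀ β : G →L[ℝ] ℝ, (∀ μ, β (γ μ) = 0) → β ∈ range B) {u : G}
    (hu : ∀ w, B w u = 0) : u ∈ Submodule.span ℝ (range γ) := by
  by_contra hn
  obtain ⟨ξ, hξ, hker⟩ := Submodule.exists_le_ker_of_notMem hn
  obtain ⟨w, hw⟩ := h (LinearMap.toContinuousLinearMap ξ)
    fun μ => hker (Submodule.subset_span (mem_range_self μ))
  exact hξ ((DFunLike.congr_fun hw u).symm.trans (hu w))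

variable [Fintype ι] {n : WithTop ℕ∞}

theorem exists_contDiffAt_coefficients {g₀ : ι → G} (hg₀ : LinearIndependent ℝ g₀) :
    ∃ Ψ : (ι → G) × G → ι → ℝ, (∀ b, ContDiffAt ℝ n Ψ (g₀, b)) ∧
      ∀ᶠ g in 𝓝 g₀, ∀ c : ι → ℝ, Ψ (g, ∑ μ, c μ • g μ) = c := by
  obtain ⟨P₀, hP₀⟩ := (Fintype.linearCombination ℝ g₀).exists_leftInverse_of_injective
    (LinearMap.ker_eq_bot.2 hg₀.fintypeLinearCombination_injective)
  let P : G →L[ℝ] (ι → ℝ) := LinearMap.toContinuousLinearMap P₀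
  -- Near `g₀` the coefficients of `b` in the family `g` are `(A g)⁻¹ (P b)`, as `A g₀ = 1`.
  let A : (ι → G) → (ι → ℝ) →L[ℝ] (ι → ℝ) := fun g =>
    ∑ ν, (ContinuousLinearMap.proj ν : (ι → ℝ) →L[ℝ] ℝ).smulRight (P (g ν))
  have hA_apply : ∀ g c, A g c = P (∑ ν, c ν • g ν) := fun g c => by
    simp only [A, sum_apply, ContinuousLinearMap.smulRight_apply, ContinuousLinearMap.proj_apply,
      map_sum, map_smul]
  have hA₀ : A g₀ = 1 := ContinuousLinearMap.ext fun c =>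
    (hA_apply g₀ c).trans (DFunLike.congr_fun hP₀ c)
  have hA : ContDiff ℝ n A := ContDiff.sum fun ν _ =>
    contDiff_const.smulRight (P.contDiff.comp (contDiff_apply ℝ G ν))
  refine ⟨fun y => Ring.inverse (A y.1) (P y.2), fun b => ?_, ?_⟩
  · have hinv : ContDiffAt ℝ n Ring.inverse (A g₀) := by
      rw [hA₀]
      exact contDiffAt_ringInverse ℝ (1 : ((ι → ℝ) →L[ℝ] (ι → ℝ))ˣ)
    exact (ContDiffAt.comp (g₀, b) hinv (hA.contDiffAt.comp _ contDiffAt_fst)).clm_apply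
      (P.contDiff.contDiffAt.comp _ contDiffAt_snd)
  · have hunit : ∀ᶠ g in 𝓝 g₀, IsUnit (A g) :=
      hA.continuous.continuousAt.eventually
        (Units.isOpen.mem_nhds (by rw [hA₀]; exact isUnit_one))
    filter_upwards [hunit] with g hg c
    rw [← hA_apply, ← mul_apply_eq_comp, Ring.inverse_mul_cancel _ hg]
    rfl

variable {F : Type*} [NormedAddCommGroup F] [NormedSpace ℝ F] {H : Type*} [TopologicalSpace H]
  {I : ModelWithCorners ℝ F H} {N : Type*} [TopologicalSpace N] [ChartedSpace H N]

theorem contMDiffAt_coefficients {γ : ι → N → G} {b : N → G} {c : ι → N → ℝ} {x : N}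
    (hγ : ∀ μ, ContMDiffAt I 𝓘(ℝ, G) n (γ μ) x) (hb : ContMDiffAt I 𝓘(ℝ, G) n b x)
    (hi : LinearIndependent ℝ fun μ => γ μ x) (h : ∀ᶠ y in 𝓝 x, b y = ∑ μ, c μ y • γ μ y) (μ : ι) :
    ContMDiffAt I 𝓘(ℝ, ℝ) n (c μ) x := by
  obtain ⟨Ψ, hΨ, hcoeff⟩ := exists_contDiffAt_coefficients (n := n) hi
  have hγ' : ContMDiffAt I 𝓘(ℝ, ι → G) n (fun y ν => γ ν y) x := contMDiffAt_pi_space.2 hγ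
  have hcomp : ContMDiffAt I 𝓘(ℝ, ι → ℝ) n (fun y => Ψ (fun ν => γ ν y, b y)) x :=
    ContDiffAt.comp_contMDiffAt (g := Ψ) (f := fun y => (fun ν => γ ν y, b y)) (hΨ (b x))
      (hγ'.prodMk_space hb)
  suffices h : ContMDiffAt I 𝓘(ℝ, ι → ℝ) n (fun y ν => c ν y) x from contMDiffAt_pi_space.1 h μ
  refine hcomp.congr_of_eventuallyEq ?_
  filter_upwards [h, hγ'.continuousAt.eventually hcoeff] with y hy hyΨ
  rw [hy]
  exact (hyΨ fun ν => c ν y).symm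

end LinearAlgebra

/-! ### Tangent vectors of a level set -/

section Submanifolds

variable {G : Type*} [NormedAddCommGroup G] [NormedSpace ℝ G] {ι : Type*}

theorem fderiv_apply_eq_zero_of_vanishing [CompleteSpace G] [Finite ι] {φ : ι → G → ℝ}
    {φ' : ι → G →L[ℝ] ℝ} {g : G → ℝ} {g' : G →L[ℝ] ℝ} {y Y : G}
    (hφ : ∀ μ, HasStrictFDerivAt (φ μ) (φ' μ) y) (hg : HasStrictFDerivAt g g' y)
    (hy : ∀ μ, φ μ y = 0) (hi : LinearIndependent ℝ φ')
    (hvan : ∀ᶠ x in 𝓝 y, (∀ μ, φ μ x = 0) → g x = 0) (hY : ∀ μ, φ' μ Y = 0) : g' Y = 0 := by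
  have := Fintype.ofFinite ι
  have hext : IsLocalExtrOn g {x | ∀ μ, φ μ x = φ μ y} y := by
    refine Or.inl (Filter.eventually_inf_principal.2 (hvan.mono fun x hx hxS => ?_))
    rw [hvan.self_of_nhds hy, hx fun μ => (hxS μ).trans (hy μ)]
  obtain ⟨Λ, Λ₀, hne, hsum⟩ := hext.exists_multipliers_of_hasStrictFDerivAt hφ hg
  have hΛ₀ : Λ₀ ≠ 0 := by
    rintro rfl
    rw [zero_smul, add_zero] at hsum
    exact hne (Prod.ext (funext (Fintype.linearIndependent_iff.1 hi Λ hsum)) rfl)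
  have hsumY := DFunLike.congr_fun hsum Y
  simp only [add_apply, sum_apply, smul_apply, hY, smul_eq_mul, mul_zero,
    Finset.sum_const_zero, zero_add, zero_apply] at hsumY
  exact (mul_eq_zero.1 hsumY).resolve_left hΛ₀

variable {K : Type*} [TopologicalSpace K] {J : ModelWithCorners ℝ G K} [J.Boundaryless]
  {N : Type*} [TopologicalSpace N] [ChartedSpace K N] {O S : Set N} {p : N}

theorem hasStrictFDerivAt_comp_extChartAt_symm {f : N → ℝ} {n : WithTop ℕ∞}
    (hf : ContMDiffAt J 𝓘(ℝ, ℝ) n f p) (hn : n ≠ 0) :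
    HasStrictFDerivAt (f ∘ (extChartAt J p).symm) (differential J f p : G →L[ℝ] ℝ)
      (extChartAt J p p) := by
  have hc : ContDiffAt ℝ n (f ∘ (extChartAt J p).symm) (extChartAt J p p) := by
    have h := (contMDiffAt_iff.1 hf).2
    rwa [J.range_eq_univ, contDiffWithinAt_univ] at h
  have hd : differential J f p = fderiv ℝ (f ∘ (extChartAt J p).symm) (extChartAt J p p) := by
    rw [differential, (hf.mdifferentiableAt hn).mfderiv, J.range_eq_univ, fderivWithin_univ]
    rfl
  rw [hd]
  exact hc.hasStrictFDerivAt hn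

theorem mem_tangentSubspace_of_differential_eq_zero [CompleteSpace G] [Finite ι] {φ : ι → N → ℝ}
    (hO : IsOpen O) (hp : p ∈ O) (hφ : ∀ μ, ContMDiffOn J 𝓘(ℝ, ℝ) ∞ (φ μ) O)
    (hφp : ∀ μ, φ μ p = 0) (hS : {x ∈ O | ∀ μ, φ μ x = 0} ⊆ S)
    (hi : LinearIndependent ℝ fun μ => differential J (φ μ) p) {X : TangentSpace J p}
    (hX : ∀ μ, differential J (φ μ) p X = 0) : X ∈ tangentSubspace J S p := by
  intro O' g hO' hp' hg hvan
  have hsmooth : ∀ {f : N → ℝ} {O : Set N}, IsOpen O → p ∈ O → ContMDiffOn J 𝓘(ℝ, ℝ) ∞ f O →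
      HasStrictFDerivAt (f ∘ (extChartAt J p).symm) (differential J f p : G →L[ℝ] ℝ)
        (extChartAt J p p) := fun hO hp hf =>
    hasStrictFDerivAt_comp_extChartAt_symm (hf.contMDiffAt (hO.mem_nhds hp)) (by simp)
  refine fderiv_apply_eq_zero_of_vanishing (G := G) (fun μ => hsmooth hO hp (hφ μ))
    (hsmooth hO' hp' hg) (fun μ => ?_) hi ?_ hX
  · exact (congrArg (φ μ) (extChartAt_to_inv p)).trans (hφp μ)
  · have hmem : ∀ᶠ y in 𝓝 (extChartAt J p p), (extChartAt J p).symm y ∈ O ∩ O' :=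
      (continuousAt_extChartAt_symm p).eventually
        ((hO.inter hO').mem_nhds (by rw [extChartAt_to_inv]; exact ⟨hp, hp'⟩))
    exact hmem.mono fun y hy h => hvan _ ⟨hS ⟨hy.1, h⟩, hy.2⟩

theorem mfderiv_extChartAt_self [IsManifold J 1 N] (x : N) (X : G) :
    (mfderiv J 𝓘(ℝ, G) (extChartAt J x) x X : G) = X := by
  have h : writtenInExtChartAt J 𝓘(ℝ, G) x (extChartAt J x) =ᶠ[𝓝 (extChartAt J x x)] id :=
    Filter.mem_of_superset ((isOpen_extChartAt_target x).mem_nhds (mem_extChartAt_target x))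
      fun z hz => (extChartAt J x).right_inv hz
  rw [(mdifferentiableAt_extChartAt (mem_chart_source K x)).mfderiv, J.range_eq_univ,
    fderivWithin_univ, h.fderiv_eq, fderiv_id]
  rfl

end Submanifolds

/-! ### The Euler-Lagrange form in coordinates -/

section TangentLift

/-- The partial derivative `∂f/∂u` of a function on `E × E` with coordinates `(x, u)`. -/
def fderivSnd (f : E × E → ℝ) (z : E × E) : E →L[ℝ] ℝ :=
  (fderiv ℝ f z).comp (ContinuousLinearMap.inr ℝ E E)

theorem contDiffAt_fderivSnd {f : E × E → ℝ} {z : E × E} (hf : ContDiffAt ℝ ∞ f z) :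
    ContDiffAt ℝ ∞ (fderivSnd f) z :=
  (hf.fderiv_right (m := ∞) le_rfl).clm_comp contDiffAt_const

/-- The Euler-Lagrange form `∂f/∂x - X(∂f/∂u)` of a function `f` on `E × E` with coordinates
`(x, u)`. -/
def elForm (f : E × E → ℝ) (z X : E × E) : E →L[ℝ] ℝ :=
  (fderiv ℝ f z).comp (ContinuousLinearMap.inl ℝ E E) - fderiv ℝ (fderivSnd f) z X

theorem contDiffAt_elForm {f : E × E → ℝ} {z : E × E} (hf : ContDiffAt ℝ ∞ f z) (X : E × E) :
    ContDiffAt ℝ ∞ (fun y : (E × E) × (E × E) => elForm f y.1 y.2) (z, X) := by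
  have hD : ContDiffAt ℝ ∞ (fun y : (E × E) × (E × E) => fderiv ℝ f y.1) (z, X) :=
    ContDiffAt.comp (g := fderiv ℝ f) (z, X) (hf.fderiv_right (m := ∞) le_rfl) contDiffAt_fst
  have hDD : ContDiffAt ℝ ∞ (fun y : (E × E) × (E × E) => fderiv ℝ (fderivSnd f) y.1) (z, X) :=
    ContDiffAt.comp (g := fderiv ℝ (fderivSnd f)) (z, X)
      ((contDiffAt_fderivSnd hf).fderiv_right (m := ∞) le_rfl) contDiffAt_fst
  exact (hD.clm_comp contDiffAt_const).sub (hDD.clm_apply contDiffAt_snd)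

theorem elForm_congr {f g : E × E → ℝ} {z : E × E} (hfg : f =ᶠ[𝓝 z] g) (X : E × E) :
    elForm f z X = elForm g z X := by
  have hsnd : fderivSnd f =ᶠ[𝓝 z] fderivSnd g :=
    hfg.fderiv.mono fun y hy => congrArg (fun A => A.comp (ContinuousLinearMap.inr ℝ E E)) hy
  rw [elForm, elForm, hfg.fderiv_eq, hsnd.fderiv_eq]

variable {F : Type*} [NormedAddCommGroup F] [NormedSpace ℝ F]

/-- The tangent map of `ψ : E → F`, as a map `E × E → F × F`. -/
def tangentLift (ψ : E → F) (z : E × E) : F × F := (ψ z.1, fderiv ℝ ψ z.1 z.2)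

variable {ψ : E → F} {z : E × E}

theorem hasFDerivAt_fderiv_comp_fst (hψ : ContDiffAt ℝ 2 ψ z.1) :
    HasFDerivAt (fun y : E × E => fderiv ℝ ψ y.1)
      ((fderiv ℝ (fderiv ℝ ψ) z.1).comp (ContinuousLinearMap.fst ℝ E E)) z :=
  ((hψ.fderiv_right (m := 1) le_rfl).differentiableAt one_ne_zero).hasFDerivAt.comp z
    hasFDerivAt_fst

theorem hasFDerivAt_tangentLift (hψ : ContDiffAt ℝ 2 ψ z.1) :
    HasFDerivAt (tangentLift ψ)
      (((fderiv ℝ ψ z.1).comp (ContinuousLinearMap.fst ℝ E E)).prod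
        ((fderiv ℝ ψ z.1).comp (ContinuousLinearMap.snd ℝ E E) +
          ((fderiv ℝ (fderiv ℝ ψ) z.1).comp (ContinuousLinearMap.fst ℝ E E)).flip z.2)) z :=
  ((hψ.differentiableAt two_ne_zero).hasFDerivAt.comp z hasFDerivAt_fst).prodMk
    ((hasFDerivAt_fderiv_comp_fst hψ).clm_apply hasFDerivAt_snd)

theorem fderiv_tangentLift_apply (hψ : ContDiffAt ℝ 2 ψ z.1) (a b : E) :
    fderiv ℝ (tangentLift ψ) z (a, b) =
      (fderiv ℝ ψ z.1 a, fderiv ℝ ψ z.1 b + fderiv ℝ (fderiv ℝ ψ) z.1 a z.2) :=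
  DFunLike.congr_fun (hasFDerivAt_tangentLift hψ).fderiv (a, b)

theorem contDiffAt_tangentLift (hψ : ContDiffAt ℝ ∞ ψ z.1) : ContDiffAt ℝ ∞ (tangentLift ψ) z :=
  (hψ.comp z contDiffAt_fst).prodMk
    (((hψ.fderiv_right (m := ∞) le_rfl).comp z contDiffAt_fst).clm_apply contDiffAt_snd)

variable {f : E × E → ℝ} {g : F × F → ℝ}

theorem fderiv_comp_tangentLift_apply (hψ : ContDiffAt ℝ 2 ψ z.1)
    (hg : DifferentiableAt ℝ g (tangentLift ψ z)) (a b : E) :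
    fderiv ℝ (g ∘ tangentLift ψ) z (a, b) =
      fderiv ℝ g (tangentLift ψ z)
        (fderiv ℝ ψ z.1 a, fderiv ℝ ψ z.1 b + fderiv ℝ (fderiv ℝ ψ) z.1 a z.2) := by
  rw [fderiv_comp z hg (hasFDerivAt_tangentLift hψ).differentiableAt,
    ContinuousLinearMap.comp_apply, fderiv_tangentLift_apply hψ]

theorem fderivSnd_comp_tangentLift (hψ : ContDiffAt ℝ 2 ψ z.1)
    (hg : DifferentiableAt ℝ g (tangentLift ψ z)) :
    fderivSnd (g ∘ tangentLift ψ) z =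
      (fderivSnd g (tangentLift ψ z)).comp (fderiv ℝ ψ z.1) := by
  ext b
  refine (fderiv_comp_tangentLift_apply hψ hg 0 b).trans ?_
  rw [map_zero, map_zero, zero_apply, add_zero]
  rfl

theorem fderiv_fderivSnd_comp_tangentLift_apply (hψ : ContDiffAt ℝ ∞ ψ z.1)
    (hg : ContDiffAt ℝ ∞ g (tangentLift ψ z)) (X : E × E) (a : E) :
    fderiv ℝ (fderivSnd (g ∘ tangentLift ψ)) z X a =
      fderivSnd g (tangentLift ψ z) (fderiv ℝ (fderiv ℝ ψ) z.1 X.1 a) +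
        fderiv ℝ (fderivSnd g) (tangentLift ψ z) (fderiv ℝ (tangentLift ψ) z X)
          (fderiv ℝ ψ z.1 a) := by
  have hψ₂ : ContDiffAt ℝ 2 ψ z.1 := hψ.of_le (WithTop.coe_le_coe.2 le_top)
  have hg₂ : ContDiffAt ℝ 2 g (tangentLift ψ z) := hg.of_le (WithTop.coe_le_coe.2 le_top)
  have hcomp : fderivSnd (g ∘ tangentLift ψ) =ᶠ[𝓝 z]
      fun y => (fderivSnd g (tangentLift ψ y)).comp (fderiv ℝ ψ y.1) := by
    filter_upwards [continuousAt_fst.eventually (hψ₂.eventually (by simp)),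
      (contDiffAt_tangentLift hψ).continuousAt.eventually (hg₂.eventually (by simp))] with y hy hgy
    exact fderivSnd_comp_tangentLift hy (hgy.differentiableAt two_ne_zero)
  have hD : HasFDerivAt (fun y => fderivSnd g (tangentLift ψ y)) _ z :=
    ((contDiffAt_fderivSnd hg).differentiableAt (by simp)).hasFDerivAt.comp z
      ((contDiffAt_tangentLift hψ).differentiableAt (by simp)).hasFDerivAt
  rw [hcomp.fderiv_eq, (hD.clm_comp (hasFDerivAt_fderiv_comp_fst hψ₂)).fderiv]
  rfl

/-- The terms in the second derivative of `ψ` cancel because the `x`-component of the second-order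
vector is the velocity `z.2`. -/
theorem elForm_comp_tangentLift (hψ : ContDiffAt ℝ ∞ ψ z.1)
    (hg : ContDiffAt ℝ ∞ g (tangentLift ψ z)) (w a : E) :
    elForm (g ∘ tangentLift ψ) z (z.2, w) a =
      elForm g (tangentLift ψ z) (fderiv ℝ (tangentLift ψ) z (z.2, w)) (fderiv ℝ ψ z.1 a) := by
  have hψ₂ : ContDiffAt ℝ 2 ψ z.1 := hψ.of_le (WithTop.coe_le_coe.2 le_top)
  have hsymm : fderiv ℝ (fderiv ℝ ψ) z.1 a z.2 = fderiv ℝ (fderiv ℝ ψ) z.1 z.2 a :=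
    (hψ₂.isSymmSndFDerivAt (by simp)).eq a z.2
  have hx : fderiv ℝ (g ∘ tangentLift ψ) z (a, 0) =
      fderiv ℝ g (tangentLift ψ z) (fderiv ℝ ψ z.1 a, 0) +
        fderivSnd g (tangentLift ψ z) (fderiv ℝ (fderiv ℝ ψ) z.1 z.2 a) := by
    rw [fderiv_comp_tangentLift_apply hψ₂ (hg.differentiableAt (by simp)), map_zero, zero_add,
      hsymm, fderivSnd, ContinuousLinearMap.comp_apply, ← map_add]
    exact congrArg _ (Prod.ext (add_zero _).symm (zero_add _).symm)
  have hu := fderiv_fderivSnd_comp_tangentLift_apply hψ hg (z.2, w) a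
  exact (congrArg₂ (· - ·) hx hu).trans ((congrArg _ (add_comm _ _)).trans
    (add_sub_add_right_eq_sub _ _ _))

end TangentLift

variable {Q : Type*} [TopologicalSpace Q] [ChartedSpace E Q] [IsManifold 𝓘(ℝ, E) ∞ Q]

/-! ### Natural coordinates on `TQ` and `T*Q` -/

/-- The components in the chart at `q₀` of a tangent vector at `q`. -/
def toFrame (q₀ q : Q) : E →L[ℝ] E := tangentCoordChange 𝓘(ℝ, E) q q₀ q

/-- The tangent vector at `q` with given components in the chart at `q₀`. -/
def ofFrame (q₀ q : Q) : E →L[ℝ] E := tangentCoordChange 𝓘(ℝ, E) q₀ q q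

theorem toFrame_ofFrame {q₀ q : Q} (hq : q ∈ (chartAt E q₀).source) (u : E) :
    toFrame q₀ q (ofFrame q₀ q u) = u := by
  have hq₀ : q ∈ (extChartAt 𝓘(ℝ, E) q₀).source := by rwa [extChartAt_source]
  rw [toFrame, ofFrame, tangentCoordChange_comp ⟨⟨hq₀, mem_extChartAt_source q⟩, hq₀⟩,
    tangentCoordChange_self hq₀]

theorem ofFrame_comp_toFrame {q₀ q : Q} (hq : q ∈ (chartAt E q₀).source) :
    (ofFrame q₀ q).comp (toFrame q₀ q) = ContinuousLinearMap.id ℝ E := by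
  have hq₀ : q ∈ (extChartAt 𝓘(ℝ, E) q₀).source := by rwa [extChartAt_source]
  have hqq : q ∈ (extChartAt 𝓘(ℝ, E) q).source := mem_extChartAt_source q
  ext u
  exact (tangentCoordChange_comp ⟨⟨hqq, hq₀⟩, hqq⟩).trans (tangentCoordChange_self hqq)

theorem toFrame_self (q : Q) : toFrame q q = ContinuousLinearMap.id ℝ E :=
  ContinuousLinearMap.ext fun _ => tangentCoordChange_self (mem_extChartAt_source q)

theorem ofFrame_self (q : Q) : ofFrame q q = ContinuousLinearMap.id ℝ E :=
  ContinuousLinearMap.ext fun _ => tangentCoordChange_self (mem_extChartAt_source q)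

/-- The inclusion of the fibre `T*_q Q` in `T*Q`. -/
def coFibreIncl (q : Q) (β : E →L[ℝ] ℝ) : CoTQ E Q := ⟨q, β⟩

/-- The natural chart of `TQ` induced by the chart of `Q` at `q₀`; it is definitionally the
preferred chart at each point of the fibre `T_{q₀} Q`. -/
def tqChart (q₀ : Q) : PartialEquiv (TQ E Q) (E × E) :=
  extChartAt (modelTQ E) (fibreIncl q₀ (0 : E))

theorem mem_tqChart_source {q₀ : Q} {v : TQ E Q} :
    v ∈ (tqChart q₀).source ↔ v.proj ∈ (chartAt E q₀).source := by
  rw [tqChart, extChartAt_source, TangentBundle.mem_chart_source_iff]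
  rfl

theorem mem_tqChart_target {q₀ : Q} {z : E × E} :
    z ∈ (tqChart (Q := Q) q₀).target ↔ z.1 ∈ (chartAt E q₀).target := by
  rw [tqChart, extChartAt_target, (modelTQ E).range_eq_univ, inter_univ]
  exact TangentBundle.mem_chart_target_iff (I := 𝓘(ℝ, E)) z (fibreIncl q₀ (0 : E))

theorem tqChart_fibreIncl (q₀ q : Q) (w : E) :
    tqChart q₀ (fibreIncl q w) = (chartAt E q₀ q, toFrame q₀ q w) := rfl

theorem tqChart_symm_apply {q₀ : Q} {z : E × E} (hz : z.1 ∈ (chartAt E q₀).target) :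
    (tqChart q₀).symm z =
      fibreIncl ((chartAt E q₀).symm z.1) (ofFrame q₀ ((chartAt E q₀).symm z.1) z.2) := by
  have hs := (chartAt E q₀).map_target hz
  refine (tqChart q₀).injOn ((tqChart q₀).map_target (mem_tqChart_target.2 hz))
    (mem_tqChart_source.2 hs) ?_
  rw [(tqChart q₀).right_inv (mem_tqChart_target.2 hz), tqChart_fibreIncl]
  exact Prod.ext ((chartAt E q₀).right_inv hz).symm (toFrame_ofFrame hs _).symm

/-- The natural chart of `T*Q` induced by the chart of `Q` at `q₀`; it is definitionally the
preferred chart at each point of the fibre `T*_{q₀} Q`. -/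
def coChart (q₀ : Q) : PartialEquiv (CoTQ E Q) (E × (E →L[ℝ] ℝ)) :=
  extChartAt (modelCoTQ E) (coFibreIncl q₀ (0 : E →L[ℝ] ℝ))

theorem mem_coChart_source {q₀ : Q} {p : CoTQ E Q} :
    p ∈ (coChart q₀).source ↔ p.proj ∈ (chartAt E q₀).source := by
  rw [coChart, extChartAt_source, FiberBundle.chartedSpace_chartAt]
  simp only [mfld_simps, coFibreIncl]
  exact ⟨fun h => h.1.1, fun h => ⟨⟨h, trivial⟩, h⟩⟩

theorem mem_coChart_target {q₀ : Q} {z : E × (E →L[ℝ] ℝ)} :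
    z ∈ (coChart (Q := Q) q₀).target ↔ z.1 ∈ (chartAt E q₀).target := by
  rw [coChart, extChartAt_target, FiberBundle.chartedSpace_chartAt, (modelCoTQ E).range_eq_univ,
    inter_univ]
  simp only [mfld_simps, coFibreIncl]
  exact ⟨fun h => h.1.1, fun h => ⟨⟨h, trivial⟩, (chartAt E q₀).map_target h, trivial⟩⟩

theorem coChart_coFibreIncl {q₀ q : Q} (hq : q ∈ (chartAt E q₀).source) (β : E →L[ℝ] ℝ) :
    coChart q₀ (coFibreIncl q β) = (chartAt E q₀ q, β.comp (ofFrame q₀ q)) := by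
  refine Prod.ext rfl (ContinuousLinearMap.ext fun u => ?_)
  refine Eq.trans ?_ (congrArg β
    (DFunLike.congr_fun (TangentBundle.symmL_trivializationAt_eq_core (I := 𝓘(ℝ, E)) hq) u))
  exact DFunLike.congr_fun (Bundle.Trivial.continuousLinearMapAt_trivialization ℝ Q ℝ q) _

theorem coChart_self_coFibreIncl (q : Q) (β : E →L[ℝ] ℝ) :
    coChart q (coFibreIncl q β) = (chartAt E q q, β) := by
  rw [coChart_coFibreIncl (mem_chart_source E q), ofFrame_self, ContinuousLinearMap.comp_id]

theorem eventually_proj_mem_chartAt_source (v : TQ E Q) :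
    ∀ᶠ y : TQ E Q in 𝓝 v, y.proj ∈ (chartAt E v.proj).source :=
  ((chartAt E v.proj).open_source.preimage
    (FiberBundle.continuous_proj E (TangentSpace 𝓘(ℝ, E)))).mem_nhds (mem_chart_source E v.proj)

theorem isOpen_tqChart_target (q₀ : Q) : IsOpen (tqChart (E := E) q₀).target :=
  isOpen_extChartAt_target _

theorem isOpen_coChart_target (q₀ : Q) : IsOpen (coChart (E := E) q₀).target :=
  isOpen_extChartAt_target _

theorem contMDiffAt_tqChart {q₀ : Q} {v : TQ E Q} (hq : v.proj ∈ (chartAt E q₀).source) :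
    ContMDiffAt (modelTQ E) 𝓘(ℝ, E × E) ∞ (tqChart q₀) v :=
  contMDiffAt_extChartAt' (by rwa [← extChartAt_source (modelTQ E), ← tqChart, mem_tqChart_source])

theorem contMDiffAt_tqChart_symm {q₀ : Q} {z : E × E} (hz : z ∈ (tqChart (Q := Q) q₀).target) :
    ContMDiffAt 𝓘(ℝ, E × E) (modelTQ E) ∞ (tqChart q₀).symm z :=
  (contMDiffOn_extChartAt_symm _).contMDiffAt ((isOpen_tqChart_target q₀).mem_nhds hz)

theorem contMDiffAt_coChart {q₀ : Q} {p : CoTQ E Q} (hq : p.proj ∈ (chartAt E q₀).source) :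
    ContMDiffAt (modelCoTQ E) 𝓘(ℝ, E × (E →L[ℝ] ℝ)) ∞ (coChart q₀) p :=
  contMDiffAt_extChartAt' (by
    rwa [← extChartAt_source (modelCoTQ E), ← coChart, mem_coChart_source])

theorem contMDiffAt_coChart_symm {q₀ : Q} {z : E × (E →L[ℝ] ℝ)}
    (hz : z ∈ (coChart (Q := Q) q₀).target) :
    ContMDiffAt 𝓘(ℝ, E × (E →L[ℝ] ℝ)) (modelCoTQ E) ∞ (coChart q₀).symm z :=
  (contMDiffOn_extChartAt_symm _).contMDiffAt ((isOpen_coChart_target q₀).mem_nhds hz)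

/-! ### The fibres of `TQ` and `T*Q` -/

theorem contMDiff_fibreIncl (q : Q) : ContMDiff 𝓘(ℝ, E) (modelTQ E) ∞ (fibreIncl (E := E) q) := by
  intro w
  refine contMDiffAt_iff_target.2 ⟨(hasMFDerivAt_fibreIncl q w).continuousAt, ?_⟩
  have h : extChartAt (modelTQ E) (fibreIncl q w) ∘ fibreIncl (E := E) q =
      fun u => (chartAt E q q, u) :=
    funext fun u => (tqChart_fibreIncl q q u).trans
      (congrArg _ (DFunLike.congr_fun (toFrame_self q) u))
  rw [h]
  exact contMDiffAt_const.prodMk_space contMDiffAt_id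

theorem extChartAt_comp_coFibreIncl (q : Q) (β : E →L[ℝ] ℝ) :
    extChartAt (modelCoTQ E) (coFibreIncl q β) ∘ coFibreIncl q = fun η => (chartAt E q q, η) :=
  funext (coChart_self_coFibreIncl q)

theorem continuous_coFibreIncl (q : Q) : Continuous (coFibreIncl (E := E) q) := by
  have h : coFibreIncl (E := E) q = fun η => (coChart q).symm (chartAt E q q, η) := by
    funext η
    rw [← coChart_self_coFibreIncl,
      (coChart q).left_inv (mem_coChart_source.2 (mem_chart_source E q))]
  rw [h, continuous_iff_continuousAt]
  exact fun η => ContinuousAt.comp (contMDiffAt_coChart_symm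
    (mem_coChart_target.2 (mem_chart_target E q))).continuousAt
    (continuousAt_const.prodMk continuousAt_id)

theorem contMDiff_coFibreIncl (q : Q) :
    ContMDiff 𝓘(ℝ, E →L[ℝ] ℝ) (modelCoTQ E) ∞ (coFibreIncl (E := E) q) := by
  intro β
  refine contMDiffAt_iff_target.2 ⟨(continuous_coFibreIncl q).continuousAt, ?_⟩
  rw [extChartAt_comp_coFibreIncl]
  exact contMDiffAt_const.prodMk_space contMDiffAt_id

theorem hasMFDerivAt_coFibreIncl (q : Q) (β : E →L[ℝ] ℝ) :
    HasMFDerivAt 𝓘(ℝ, E →L[ℝ] ℝ) (modelCoTQ E) (coFibreIncl (E := E) q) β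
      (ContinuousLinearMap.inr ℝ E (E →L[ℝ] ℝ)) := by
  refine ⟨(continuous_coFibreIncl q).continuousAt, ?_⟩
  have h : writtenInExtChartAt 𝓘(ℝ, E →L[ℝ] ℝ) (modelCoTQ E) β (coFibreIncl (E := E) q) =
      fun η => (chartAt E q q, η) := extChartAt_comp_coFibreIncl q β
  rw [h]
  exact (hasFDerivAt_prodMk_right _ _).hasFDerivWithinAt

theorem hasMFDerivAt_coProj (p : CoTQ E Q) :
    HasMFDerivAt (modelCoTQ E) 𝓘(ℝ, E) (TotalSpace.proj : CoTQ E Q → Q) p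
      (ContinuousLinearMap.fst ℝ E (E →L[ℝ] ℝ)) := by
  refine ⟨(FiberBundle.continuous_proj (E →L[ℝ] ℝ) _).continuousAt, ?_⟩
  have hwritten : ∀ z ∈ (coChart p.proj).target,
      writtenInExtChartAt (modelCoTQ E) 𝓘(ℝ, E) p (TotalSpace.proj : CoTQ E Q → Q) z = z.1 :=
    fun z hz => congrArg Prod.fst ((coChart p.proj).right_inv hz)
  exact hasFDerivAt_fst.hasFDerivWithinAt.congr_of_eventuallyEq
    (Filter.mem_of_superset (extChartAt_target_mem_nhdsWithin (I := modelCoTQ E) p) hwritten)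
    (hwritten _ (mem_extChartAt_target p))

/-! ### Local expressions of functions -/

/-- The local expression of a function on `TQ` in the natural chart at `q₀`. -/
def loc (f : TQ E Q → ℝ) (q₀ : Q) (z : E × E) : ℝ := f ((tqChart q₀).symm z)

/-- The local expression of a function on `T*Q` in the natural chart at `q₀`. -/
def coLoc (h : CoTQ E Q → ℝ) (q₀ : Q) (z : E × (E →L[ℝ] ℝ)) : ℝ := h ((coChart q₀).symm z)

theorem loc_apply (f : TQ E Q → ℝ) {q₀ q : Q} (hq : q ∈ (chartAt E q₀).source) (w : E) :
    loc f q₀ (chartAt E q₀ q, toFrame q₀ q w) = f (fibreIncl q w) :=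
  congrArg f ((tqChart q₀).left_inv (x := fibreIncl q w) (mem_tqChart_source.2 hq))

theorem coLoc_apply (h : CoTQ E Q → ℝ) {q₀ q : Q} (hq : q ∈ (chartAt E q₀).source)
    (β : E →L[ℝ] ℝ) :
    coLoc h q₀ (chartAt E q₀ q, β) = h (coFibreIncl q (β.comp (toFrame q₀ q))) := by
  have hβ : (β.comp (toFrame q₀ q)).comp (ofFrame q₀ q) = β :=
    ContinuousLinearMap.ext fun u => congrArg β (toFrame_ofFrame hq u)
  have hchart := coChart_coFibreIncl hq (β.comp (toFrame q₀ q))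
  rw [hβ] at hchart
  rw [coLoc, ← hchart, (coChart q₀).left_inv (mem_coChart_source.2 hq)]

theorem contDiffAt_loc {f : TQ E Q → ℝ} {q₀ : Q} {v : TQ E Q}
    (hf : ContMDiffAt (modelTQ E) 𝓘(ℝ, ℝ) ∞ f v) (hq : v.proj ∈ (chartAt E q₀).source) :
    ContDiffAt ℝ ∞ (loc f q₀) (tqChart q₀ v) := by
  have hv := mem_tqChart_source.2 hq
  refine ContMDiffAt.contDiffAt (ContMDiffAt.comp (g := f) _ ?_
    (contMDiffAt_tqChart_symm ((tqChart q₀).map_source hv)))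
  rwa [(tqChart q₀).left_inv hv]

theorem contDiffAt_coLoc {h : CoTQ E Q → ℝ} {q₀ : Q} {p : CoTQ E Q}
    (hh : ContMDiffAt (modelCoTQ E) 𝓘(ℝ, ℝ) ∞ h p) (hq : p.proj ∈ (chartAt E q₀).source) :
    ContDiffAt ℝ ∞ (coLoc h q₀) (coChart q₀ p) := by
  have hp := mem_coChart_source.2 hq
  refine ContMDiffAt.contDiffAt (ContMDiffAt.comp (g := h) _ ?_
    (contMDiffAt_coChart_symm ((coChart q₀).map_source hp)))
  rwa [(coChart q₀).left_inv hp]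

theorem coLoc_comp_toFrame (h : CoTQ E Q → ℝ) {q₀ : Q} {p : CoTQ E Q}
    (hq : p.proj ∈ (chartAt E q₀).source) :
    (fun η => coLoc h q₀ ((coChart q₀ p).1, η)) =
      fun η => (h ∘ coFibreIncl p.proj) (η.comp (toFrame q₀ p.proj)) :=
  funext fun η => coLoc_apply h hq η

theorem coChart_snd_comp_toFrame {q₀ q : Q} (hq : q ∈ (chartAt E q₀).source) (β : E →L[ℝ] ℝ) :
    (coChart q₀ (coFibreIncl q β)).2.comp (toFrame q₀ q) = β := by
  rw [coChart_coFibreIncl hq]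
  exact (ContinuousLinearMap.comp_assoc _ _ _).trans
    ((congrArg β.comp (ofFrame_comp_toFrame hq)).trans β.comp_id)

theorem contMDiffAt_toFrame_snd {v : TQ E Q} :
    ContMDiffAt (modelTQ E) 𝓘(ℝ, E) ∞ (fun y => toFrame (E := E) v.proj y.proj y.2) v :=
  (contDiff_snd (𝕜 := ℝ) (E := E) (F := E)).contDiffAt.contMDiffAt.comp v
    (contMDiffAt_tqChart (mem_chart_source E v.proj))

/-! ### The Legendre map and the fibre hessian -/

variable {L : TQ E Q → ℝ}

/-- The fibre hessian `D²L`, as a map `TQ → Hom(TQ, T*Q)`. -/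
def fibreHessian (L : TQ E Q → ℝ) (v : TQ E Q) : E →L[ℝ] E →L[ℝ] ℝ :=
  fderiv ℝ (fderiv ℝ (L ∘ fibreIncl v.proj)) v.2

theorem contDiff_comp_fibreIncl (hL : ContMDiff (modelTQ E) 𝓘(ℝ, ℝ) ∞ L) (q : Q) :
    ContDiff ℝ ∞ (L ∘ fibreIncl (E := E) q) :=
  (hL.comp (contMDiff_fibreIncl q)).contDiff

theorem fibreDeriv_eq_fderivSnd {f : TQ E Q → ℝ} {q₀ q : Q} {w : E}
    (hq : q ∈ (chartAt E q₀).source)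
    (hf : DifferentiableAt ℝ (loc f q₀) (tqChart q₀ (fibreIncl q w))) :
    fibreDeriv f (fibreIncl q w) =
      (fderivSnd (loc f q₀) (tqChart q₀ (fibreIncl q w))).comp (toFrame q₀ q) := by
  have hline : HasFDerivAt (fun u : E => (chartAt E q₀ q, toFrame q₀ q u))
      ((0 : E →L[ℝ] E).prod (toFrame q₀ q)) w :=
    (hasFDerivAt_const _ _).prodMk (toFrame q₀ q).hasFDerivAt
  have hcomp : HasFDerivAt (fun u : E => loc f q₀ (chartAt E q₀ q, toFrame q₀ q u)) _ w :=
    HasFDerivAt.comp (g := loc f q₀) w hf.hasFDerivAt hline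
  simp only [loc_apply f hq] at hcomp
  refine hcomp.fderiv.trans ?_
  ext u
  rfl

theorem coChart_legendre (hL : ContMDiff (modelTQ E) 𝓘(ℝ, ℝ) ∞ L) {q₀ : Q} {v : TQ E Q}
    (hq : v.proj ∈ (chartAt E q₀).source) :
    coChart q₀ (legendre L v) = ((tqChart q₀ v).1, fderivSnd (loc L q₀) (tqChart q₀ v)) := by
  have hD : fibreDeriv L v = (fderivSnd (loc L q₀) (tqChart q₀ v)).comp (toFrame q₀ v.proj) :=
    fibreDeriv_eq_fderivSnd hq ((contDiffAt_loc (hL v) hq).differentiableAt (by simp))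
  refine (coChart_coFibreIncl hq (fibreDeriv L v)).trans (Prod.ext rfl ?_)
  ext u
  exact (DFunLike.congr_fun hD (ofFrame q₀ v.proj u)).trans
    (congrArg (fderivSnd (loc L q₀) (tqChart q₀ v)) (toFrame_ofFrame hq u))

theorem contMDiff_legendre (hL : ContMDiff (modelTQ E) 𝓘(ℝ, ℝ) ∞ L) :
    ContMDiff (modelTQ E) (modelCoTQ E) ∞ (legendre L) := by
  intro v
  have hq : v.proj ∈ (chartAt E v.proj).source := mem_chart_source E v.proj
  have hchart := contMDiffAt_tqChart hq
  have hloc : ContMDiffAt 𝓘(ℝ, E × E) 𝓘(ℝ, E × (E →L[ℝ] ℝ)) ∞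
      (fun z : E × E => (z.1, fderivSnd (loc L v.proj) z)) (tqChart v.proj v) :=
    (contDiffAt_fst.prodMk (contDiffAt_fderivSnd (contDiffAt_loc (hL v) hq))).contMDiffAt
  refine ((contMDiffAt_coChart_symm (mem_coChart_target.2 (mem_chart_target E v.proj))).comp v
    (hloc.comp v hchart)).congr_of_eventuallyEq ?_
  filter_upwards [eventually_proj_mem_chartAt_source v] with y hy
  exact ((coChart v.proj).left_inv (mem_coChart_source.2 hy)).symm.trans
    (congrArg (coChart v.proj).symm (coChart_legendre hL hy))

theorem hasMFDerivAt_legendre (hL : ContMDiff (modelTQ E) 𝓘(ℝ, ℝ) ∞ L) (v : TQ E Q) :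
    HasMFDerivAt (modelTQ E) (modelCoTQ E) (legendre L) v
      (mfderiv (modelTQ E) (modelCoTQ E) (legendre L) v) :=
  ((contMDiff_legendre hL).mdifferentiable (by simp) v).hasMFDerivAt

theorem mfderiv_legendre_fst (hL : ContMDiff (modelTQ E) 𝓘(ℝ, ℝ) ∞ L) (v : TQ E Q)
    (X : E × E) :
    (mfderiv (modelTQ E) (modelCoTQ E) (legendre L) v X : E × (E →L[ℝ] ℝ)).1 = X.1 :=
  DFunLike.congr_fun (hasMFDerivAt_unique ((hasMFDerivAt_coProj (legendre L v)).comp v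
    (hasMFDerivAt_legendre hL v)) (hasMFDerivAt_proj v)) X

theorem mfderiv_legendre_vertical (hL : ContMDiff (modelTQ E) 𝓘(ℝ, ℝ) ∞ L) (q : Q)
    (w u : E) :
    (mfderiv (modelTQ E) (modelCoTQ E) (legendre L) (fibreIncl q w) ((0, u) : E × E) :
      E × (E →L[ℝ] ℝ)) = (0, fibreHessian L (fibreIncl q w) u) := by
  have hfib : HasFDerivAt (fderiv ℝ (L ∘ fibreIncl q)) (fibreHessian L (fibreIncl q w)) w :=
    (((contDiff_comp_fibreIncl hL q).fderiv_right (m := ∞) le_rfl).differentiable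
      (by simp) _).hasFDerivAt
  exact DFunLike.congr_fun (hasMFDerivAt_unique
    ((hasMFDerivAt_legendre hL (fibreIncl q w)).comp w (hasMFDerivAt_fibreIncl q w))
    ((hasMFDerivAt_coFibreIncl q _).comp w hfib.hasMFDerivAt)) u

theorem isOpen_legendre_preimage (hL : ContMDiff (modelTQ E) 𝓘(ℝ, ℝ) ∞ L)
    {O : Set (CoTQ E Q)} (hO : IsOpen O) : IsOpen (legendre L ⁻¹' O) :=
  hO.preimage (contMDiff_legendre hL).continuous

theorem contMDiffAt_coChart_legendre (hL : ContMDiff (modelTQ E) 𝓘(ℝ, ℝ) ∞ L) {q₀ : Q}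
    {v : TQ E Q} (hq : v.proj ∈ (chartAt E q₀).source) :
    ContMDiffAt (modelTQ E) 𝓘(ℝ, E × (E →L[ℝ] ℝ)) ∞ (fun y => coChart q₀ (legendre L y)) v :=
  ContMDiffAt.comp (g := coChart q₀) v (contMDiffAt_coChart hq) (contMDiff_legendre hL v)

/-! ### Changes of natural coordinates -/

/-- The change of coordinates from the chart of `Q` at `q` to the chart at `q₀`. -/
def baseChange (q q₀ : Q) (x : E) : E := chartAt E q₀ ((chartAt E q).symm x)

theorem contDiffAt_baseChange {q₀ q : Q} (hq : q ∈ (chartAt E q₀).source) :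
    ContDiffAt ℝ ∞ (baseChange q q₀) (chartAt E q q) := by
  have hsymm : ContMDiffAt 𝓘(ℝ, E) 𝓘(ℝ, E) ∞ (chartAt E q).symm (chartAt E q q) :=
    (contMDiffOn_chart_symm (I := 𝓘(ℝ, E)) (n := ∞) (x := q)).contMDiffAt
      ((chartAt E q).open_target.mem_nhds (mem_chart_target E q))
  refine (ContMDiffAt.comp (g := chartAt E q₀) _ ?_ hsymm).contDiffAt
  rw [(chartAt E q).left_inv (mem_chart_source E q)]
  exact (contMDiffOn_chart (I := 𝓘(ℝ, E)) (n := ∞) (x := q₀)).contMDiffAt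
    ((chartAt E q₀).open_source.mem_nhds hq)

theorem tangentCoordChange_eq_fderiv (q q₀ q' : Q) :
    tangentCoordChange 𝓘(ℝ, E) q q₀ q' = fderiv ℝ (baseChange q q₀) (chartAt E q q') := by
  rw [tangentCoordChange_def, modelWithCornersSelf_coe, range_id, fderivWithin_univ]
  rfl

theorem tqChart_comp_symm {q q₀ : Q} {z : E × E} (hz : z.1 ∈ (chartAt E q).target)
    (hz' : (chartAt E q).symm z.1 ∈ (chartAt E q₀).source) :
    tqChart q₀ ((tqChart q).symm z) = tangentLift (baseChange q q₀) z := by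
  have hchange := tangentCoordChange_eq_fderiv (E := E) q q₀ ((chartAt E q).symm z.1)
  rw [(chartAt E q).right_inv hz] at hchange
  rw [tqChart_symm_apply hz, tqChart_fibreIncl]
  refine Prod.ext rfl ((tangentCoordChange_comp ⟨⟨?_, mem_extChartAt_source _⟩, ?_⟩).trans
    (DFunLike.congr_fun hchange z.2))
  · rw [extChartAt_source]
    exact (chartAt E q).map_target hz
  · rwa [extChartAt_source]

theorem eventually_symm_mem_tqChart_source {q₀ : Q} {v : TQ E Q}
    (hq : v.proj ∈ (chartAt E q₀).source) :
    ∀ᶠ z in 𝓝 (tqChart v.proj v), (tqChart v.proj).symm z ∈ (tqChart q₀).source ∧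
      tqChart q₀ ((tqChart v.proj).symm z) = tangentLift (baseChange v.proj q₀) z := by
  have hx : (tqChart v.proj v).1 ∈ (chartAt E v.proj).target := mem_chart_target E v.proj
  have hsource : ∀ᶠ x in 𝓝 (tqChart v.proj v).1,
      (chartAt E v.proj).symm x ∈ (chartAt E q₀).source := by
    refine ((chartAt E v.proj).symm.continuousAt hx).eventually
      ((chartAt E q₀).open_source.mem_nhds ?_)
    exact ((chartAt E v.proj).left_inv (mem_chart_source E v.proj)).symm ▸ hq
  filter_upwards [continuousAt_fst.eventually ((chartAt E v.proj).open_target.mem_nhds hx),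
    continuousAt_fst.eventually hsource] with z hz hz'
  refine ⟨?_, tqChart_comp_symm hz hz'⟩
  rw [tqChart_symm_apply hz]
  exact mem_tqChart_source.2 hz'

/-- The components in the natural chart at `q₀` of a tangent vector of `TQ` at `v`. -/
def toFrameTQ (q₀ : Q) (v : TQ E Q) : E × E →L[ℝ] E × E :=
  tangentCoordChange (modelTQ E) v (fibreIncl q₀ (0 : E)) v

theorem toFrameTQ_eq_fderiv {q₀ : Q} {v : TQ E Q} (hq : v.proj ∈ (chartAt E q₀).source) :
    toFrameTQ q₀ v = fderiv ℝ (tangentLift (baseChange v.proj q₀)) (tqChart v.proj v) := by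
  rw [toFrameTQ, tangentCoordChange_def, (modelTQ E).range_eq_univ, fderivWithin_univ]
  exact Filter.EventuallyEq.fderiv_eq
    ((eventually_symm_mem_tqChart_source hq).mono fun z hz => hz.2)

theorem toFrameTQ_vertical {q₀ : Q} {v : TQ E Q} (hq : v.proj ∈ (chartAt E q₀).source) (w : E) :
    toFrameTQ q₀ v (0, w) = (0, toFrame q₀ v.proj w) := by
  have hψ : ContDiffAt ℝ 2 (baseChange v.proj q₀) (tqChart v.proj v).1 :=
    (contDiffAt_baseChange hq).of_le (WithTop.coe_le_coe.2 le_top)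
  rw [toFrameTQ_eq_fderiv hq, fderiv_tangentLift_apply hψ, map_zero, map_zero, zero_apply,
    add_zero, toFrame, tangentCoordChange_eq_fderiv]
  rfl

/-! ### The Euler-Lagrange form in natural coordinates -/

theorem eulerLagrange_eq_elForm (L : TQ E Q → ℝ) (v : TQ E Q) (X : E × E) :
    eulerLagrange L v X = elForm (loc L v.proj) (tqChart v.proj v) X := by
  have hX : (mfderiv (modelTQ E) 𝓘(ℝ, E × E) (extChartAt (modelTQ E) v) v X : E × E) = X :=
    mfderiv_extChartAt_self (J := modelTQ E) v X
  have hdx : ∀ u : E, (mfderiv 𝓘(ℝ, E) 𝓘(ℝ, E) (extChartAt 𝓘(ℝ, E) v.proj) v.proj u : E) = u :=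
    mfderiv_extChartAt_self (J := 𝓘(ℝ, E)) v.proj
  ext u
  simp only [eulerLagrange]
  rw [hX]
  exact congrArg (elForm (loc L v.proj) (tqChart v.proj v) X) (hdx u)

theorem eulerLagrange_eq_elForm_toFrame (hL : ContMDiff (modelTQ E) 𝓘(ℝ, ℝ) ∞ L) {q₀ : Q}
    {v : TQ E Q} (hq : v.proj ∈ (chartAt E q₀).source) {X : E × E} (hX : X.1 = v.2) :
    eulerLagrange L v X =
      (elForm (loc L q₀) (tqChart q₀ v) (toFrameTQ q₀ v X)).comp (toFrame q₀ v.proj) := by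
  have hev := eventually_symm_mem_tqChart_source hq
  have hv : (tqChart v.proj).symm (tqChart v.proj v) = v :=
    (tqChart v.proj).left_inv (mem_tqChart_source.2 (mem_chart_source E v.proj))
  have hz : tqChart q₀ v = tangentLift (baseChange v.proj q₀) (tqChart v.proj v) := by
    rw [← hev.self_of_nhds.2, hv]
  have hloc : loc L v.proj =ᶠ[𝓝 (tqChart v.proj v)]
      loc L q₀ ∘ tangentLift (baseChange v.proj q₀) := by
    filter_upwards [hev] with z hz
    rw [Function.comp_apply, ← hz.2, loc, loc, (tqChart q₀).left_inv hz.1]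
  have hX' : X = ((tqChart v.proj v).2, X.2) :=
    Prod.ext (hX.trans (DFunLike.congr_fun (toFrame_self (E := E) v.proj) v.2).symm) rfl
  refine (eulerLagrange_eq_elForm L v X).trans ((elForm_congr hloc X).trans ?_)
  have hg := contDiffAt_loc (hL v) hq
  rw [hz] at hg ⊢
  ext a
  rw [toFrameTQ_eq_fderiv hq, toFrame, tangentCoordChange_eq_fderiv, hX']
  exact elForm_comp_tangentLift (contDiffAt_baseChange hq) hg X.2 a

theorem fderiv_fderivSnd_loc_vertical (hL : ContMDiff (modelTQ E) 𝓘(ℝ, ℝ) ∞ L) (q : Q)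
    (w u : E) :
    fderiv ℝ (fderivSnd (loc L q)) (tqChart q (fibreIncl q w)) (0, u) =
      fibreHessian L (fibreIncl q w) u := by
  have hq := mem_chart_source E q
  have hloc : ∀ w : E, ContDiffAt ℝ ∞ (loc L q) (tqChart q (fibreIncl q w)) := fun w =>
    contDiffAt_loc (hL (fibreIncl q w)) hq
  have hchart : ∀ w : E, tqChart q (fibreIncl q w) = (chartAt E q q, w) := fun w =>
    (tqChart_fibreIncl q q w).trans (congrArg _ (DFunLike.congr_fun (toFrame_self q) w))
  have hfib : fderiv ℝ (L ∘ fibreIncl q) = fun w => fderivSnd (loc L q) (chartAt E q q, w) := by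
    funext w
    rw [← hchart]
    refine (fibreDeriv_eq_fderivSnd hq ((hloc w).differentiableAt (by simp))).trans ?_
    rw [toFrame_self, ContinuousLinearMap.comp_id]
  have hD : HasFDerivAt (fun w => fderivSnd (loc L q) (chartAt E q q, w)) _ w :=
    HasFDerivAt.comp (g := fderivSnd (loc L q)) w
      (((contDiffAt_fderivSnd (hchart w ▸ hloc w)).differentiableAt (by simp)).hasFDerivAt)
      (hasFDerivAt_prodMk_right _ w)
  rw [hchart]
  refine (DFunLike.congr_fun hD.fderiv u).symm.trans ?_
  rw [← hfib]
  rfl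

theorem coe_verticalLift (v : TQ E Q) (w : E) :
    ((verticalLift v w : TangentSpace (modelTQ E) v) : E × E) = (0, w) :=
  fibreInclDeriv_apply (E := E) v.proj v.2 w

theorem eulerLagrange_add_verticalLift_apply (hL : ContMDiff (modelTQ E) 𝓘(ℝ, ℝ) ∞ L) (v : TQ E Q)
    (X : TangentSpace (modelTQ E) v) (u a : E) :
    eulerLagrange L v (X + verticalLift v u) a = eulerLagrange L v X a - fibreHessian L v u a := by
  have hsplit : ∀ X : E × E, elForm (loc L v.proj) (tqChart v.proj v) (X + (0, u)) =
      elForm (loc L v.proj) (tqChart v.proj v) X - fibreHessian L v u := fun X => by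
    rw [elForm, map_add, ← sub_sub]
    exact congrArg (_ - ·) (fderiv_fderivSnd_loc_vertical hL v.proj v.2 u)
  have hEL := fun Y : E × E => DFunLike.congr_fun (eulerLagrange_eq_elForm L v Y) a
  rw [coe_verticalLift]
  exact (hEL _).trans ((DFunLike.congr_fun (hsplit X) a).trans (congrArg (· - _) (hEL X).symm))

theorem contMDiffAt_field_iff {X : ∀ v : TQ E Q, TangentSpace (modelTQ E) v} (v : TQ E Q) :
    ContMDiffAt (modelTQ E) (modelTQ E).tangent ∞
        (fun y => (⟨y, X y⟩ : TangentBundle (modelTQ E) (TQ E Q))) v ↔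
      ContMDiffAt (modelTQ E) 𝓘(ℝ, E × E) ∞ (fun y => toFrameTQ v.proj y (X y)) v :=
  contMDiffAt_section v

theorem mem_secondOrderVectors {v : TQ E Q} {X : TangentSpace (modelTQ E) v} :
    X ∈ secondOrderVectors v ↔ (X : E × E).1 = v.2 := by
  rw [secondOrderVectors, mem_ofPred_eq, (hasMFDerivAt_proj v).mfderiv]
  rfl

theorem add_verticalLift_mem_secondOrderVectors {v : TQ E Q} {X : TangentSpace (modelTQ E) v}
    (hX : X ∈ secondOrderVectors v) (u : E) :
    X + verticalLift v u ∈ secondOrderVectors v := by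
  rw [mem_secondOrderVectors] at hX ⊢
  exact (congrArg (fun Y : E × E => (X : E × E).1 + Y.1) (coe_verticalLift v u)).trans
    ((add_zero _).trans hX)

theorem exists_eq_add_verticalLift {v : TQ E Q} {X Y : TangentSpace (modelTQ E) v}
    (hX : X ∈ secondOrderVectors v) (hY : Y ∈ secondOrderVectors v) :
    ∃ u : E, Y = X + verticalLift v u := by
  rw [mem_secondOrderVectors] at hX hY
  have hvert : Y - X ∈ verticalSpace v :=
    (mem_verticalSpace v _).2 (sub_eq_zero.2 (hY.trans hX.symm))
  refine ⟨(verticalLift v).symm ⟨Y - X, hvert⟩, (add_sub_cancel X Y).symm.trans ?_⟩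
  exact congrArg (X + ·) (congrArg Subtype.val
    ((verticalLift v).apply_symm_apply (⟨Y - X, hvert⟩ : verticalSpace v)).symm)

theorem eulerLagrangeHat_verticalLift (L : TQ E Q → ℝ) (v : TQ E Q)
    (X : TangentSpace (modelTQ E) v) (a : E) :
    eulerLagrangeHat L v X (verticalLift v a) = eulerLagrange L v X a :=
  congrArg (eulerLagrange L v X) ((verticalLift v).symm_apply_apply a)

/-! ### Kernel and image of the fibre hessian -/

variable {H h : CoTQ E Q → ℝ} {ι : Type*} {φ : ι → CoTQ E Q → ℝ} {O : Set (CoTQ E Q)}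

theorem contDiffAt_comp_coFibreIncl {q : Q} {β : E →L[ℝ] ℝ}
    (hh : ContMDiffAt (modelCoTQ E) 𝓘(ℝ, ℝ) ∞ h (coFibreIncl q β)) :
    ContDiffAt ℝ ∞ (h ∘ coFibreIncl q) β :=
  (ContMDiffAt.comp (g := h) β hh (contMDiff_coFibreIncl q β)).contDiffAt

theorem differential_mfderiv_legendre_eq_zero (hL : ContMDiff (modelTQ E) 𝓘(ℝ, ℝ) ∞ L) {v : TQ E Q}
    (hh : ContMDiffAt (modelCoTQ E) 𝓘(ℝ, ℝ) ∞ h (legendre L v))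
    (h₀ : ∀ᶠ y in 𝓝 v, h (legendre L y) = 0) (X : TangentSpace (modelTQ E) v) :
    differential (modelCoTQ E) h (legendre L v)
      (mfderiv (modelTQ E) (modelCoTQ E) (legendre L) v X) = 0 :=
  DFunLike.congr_fun (hasMFDerivAt_unique
    ((hh.mdifferentiableAt (by simp)).hasMFDerivAt.comp v (hasMFDerivAt_legendre hL v))
    ((hasMFDerivAt_const (0 : ℝ) v).congr_of_eventuallyEq h₀)) X

theorem IsIndependentPrimaryConstraints.contMDiffAt
    (hφ : IsIndependentPrimaryConstraints L O φ) (hO : IsOpen O) {v : TQ E Q}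
    (hv : legendre L v ∈ O) (μ : ι) :
    ContMDiffAt (modelCoTQ E) 𝓘(ℝ, ℝ) ∞ (φ μ) (legendre L v) :=
  (hφ.smooth μ).contMDiffAt (hO.mem_nhds hv)

theorem IsIndependentPrimaryConstraints.apply_legendre
    (hφ : IsIndependentPrimaryConstraints L O φ) {v : TQ E Q} (hv : legendre L v ∈ O) (μ : ι) :
    φ μ (legendre L v) = 0 :=
  (hφ.defines.subset ⟨mem_range_self v, hv⟩).2 μ

theorem IsIndependentPrimaryConstraints.eventually_apply_legendre
    (hL : ContMDiff (modelTQ E) 𝓘(ℝ, ℝ) ∞ L) (hO : IsOpen O)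
    (hφ : IsIndependentPrimaryConstraints L O φ) {v : TQ E Q} (hv : legendre L v ∈ O) (μ : ι) :
    ∀ᶠ y in 𝓝 v, φ μ (legendre L y) = 0 :=
  Filter.mem_of_superset ((isOpen_legendre_preimage hL hO).mem_nhds hv)
    fun _ hy => hφ.apply_legendre hy μ

variable [FiniteDimensional ℝ E]

theorem differential_vertical {q : Q} {β : E →L[ℝ] ℝ}
    (hh : ContMDiffAt (modelCoTQ E) 𝓘(ℝ, ℝ) ∞ h (coFibreIncl q β)) (α : E →L[ℝ] ℝ) :
    differential (modelCoTQ E) h (coFibreIncl q β) ((0, α) : E × (E →L[ℝ] ℝ)) =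
      α (coFibreDeriv h (coFibreIncl q β)) := by
  let D : E × (E →L[ℝ] ℝ) →L[ℝ] ℝ := differential (modelCoTQ E) h (coFibreIncl q β)
  have hcomp : HasFDerivAt (h ∘ coFibreIncl q)
      (D.comp (ContinuousLinearMap.inr ℝ E (E →L[ℝ] ℝ))) β :=
    ((hh.mdifferentiableAt (by simp)).hasMFDerivAt.comp β
      (hasMFDerivAt_coFibreIncl q β)).hasFDerivAt
  exact (DFunLike.congr_fun hcomp.fderiv α).symm.trans
    (apply_dualGradient (h ∘ coFibreIncl q) α β).symm

theorem fibreHessian_apply_gam_eq_zero (hL : ContMDiff (modelTQ E) 𝓘(ℝ, ℝ) ∞ L) {v : TQ E Q}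
    (hh : ContMDiffAt (modelCoTQ E) 𝓘(ℝ, ℝ) ∞ h (legendre L v))
    (h₀ : ∀ᶠ y in 𝓝 v, h (legendre L y) = 0) (u : E) :
    fibreHessian L v u (gam L h v) = 0 :=
  hessian_apply_dualGradient_eq_zero
    (((contDiff_comp_fibreIncl hL v.proj).fderiv_right (m := ∞) le_rfl).differentiable (by simp) _)
    ((contDiffAt_comp_coFibreIncl hh).differentiableAt (by simp))
    ((contMDiff_fibreIncl v.proj).continuous.continuousAt.eventually h₀) u

theorem fibreHessian_apply_sub_gam_eq_zero (hL : ContMDiff (modelTQ E) 𝓘(ℝ, ℝ) ∞ L) {v : TQ E Q}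
    (hH : ContMDiffAt (modelCoTQ E) 𝓘(ℝ, ℝ) ∞ H (legendre L v))
    (hE : ∀ᶠ y in 𝓝 v, energy L y = H (legendre L y)) (u : E) :
    fibreHessian L v u (v.2 - gam L H v) = 0 :=
  hessian_apply_sub_dualGradient_eq_zero
    ((contDiff_comp_fibreIncl hL v.proj).contDiffAt.of_le (WithTop.coe_le_coe.2 le_top))
    ((contDiffAt_comp_coFibreIncl hH).differentiableAt (by simp))
    ((contMDiff_fibreIncl v.proj).continuous.continuousAt.eventually hE) u

theorem linearIndependent_gam [Finite ι] (hL : ContMDiff (modelTQ E) 𝓘(ℝ, ℝ) ∞ L) {v : TQ E Q}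
    (hφ : ∀ μ, ContMDiffAt (modelCoTQ E) 𝓘(ℝ, ℝ) ∞ (φ μ) (legendre L v))
    (h₀ : ∀ μ, ∀ᶠ y in 𝓝 v, φ μ (legendre L y) = 0)
    (hi : LinearIndependent ℝ fun μ => differential (modelCoTQ E) (φ μ) (legendre L v)) :
    LinearIndependent ℝ fun μ => (gam L (φ μ) v : E) :=
  linearIndependent_of_apply_inr_eq (F := E) (B := id) hi
    (fun x => ⟨((x, 0) : E × E), mfderiv_legendre_fst hL v (x, 0)⟩)
    (fun μ X => differential_mfderiv_legendre_eq_zero hL (hφ μ) (h₀ μ) X)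
    fun μ α => differential_vertical (hφ μ) α

theorem mem_range_fibreHessian [Finite ι] (hL : ContMDiff (modelTQ E) 𝓘(ℝ, ℝ) ∞ L)
    (hO : IsOpen O) (hφ : IsIndependentPrimaryConstraints L O φ)
    {v : TQ E Q} (hv : legendre L v ∈ O)
    (hsub : tangentSubspace (modelCoTQ E) (range (legendre L)) (legendre L v) ≤
      (mfderiv (modelTQ E) (modelCoTQ E) (legendre L) v).range)
    {β : E →L[ℝ] ℝ} (hβ : ∀ μ, β (gam L (φ μ) v) = 0) : β ∈ range (fibreHessian L v) := by
  have htan : ((0, β) : E × (E →L[ℝ] ℝ)) ∈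
      tangentSubspace (modelCoTQ E) (range (legendre L)) (legendre L v) :=
    mem_tangentSubspace_of_differential_eq_zero hO hv hφ.smooth (hφ.apply_legendre hv)
      (hφ.defines.symm.subset.trans inter_subset_left)
      (hφ.independent _ ⟨mem_range_self v, hv⟩)
      fun μ => (differential_vertical (hφ.contMDiffAt hO hv μ) β).trans (hβ μ)
  obtain ⟨X, hX⟩ := hsub htan
  have hX₁ : (X : E × E).1 = 0 := (mfderiv_legendre_fst hL v X).symm.trans (congrArg Prod.fst hX)
  have hXv : (X : E × E) = (0, (X : E × E).2) := Prod.ext hX₁ rfl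
  rw [hXv] at hX
  exact ⟨(X : E × E).2, congrArg Prod.snd
    ((mfderiv_legendre_vertical hL v.proj v.2 (X : E × E).2).symm.trans hX)⟩

/-! ### Resolutions of the identity -/

theorem exists_eq_gam_add_sum [Fintype ι] (hL : ContMDiff (modelTQ E) 𝓘(ℝ, ℝ) ∞ L)
    (hO : IsOpen O) (hφ : IsIndependentPrimaryConstraints L O φ) (hH : IsHamiltonian L O H)
    {v : TQ E Q} (hv : legendre L v ∈ O)
    (hsub : tangentSubspace (modelCoTQ E) (range (legendre L)) (legendre L v) ≤
      (mfderiv (modelTQ E) (modelCoTQ E) (legendre L) v).range) :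
    ∃ c : ι → ℝ, v.2 = gam L H v + ∑ μ, c μ • gam L (φ μ) v := by
  have hE : ∀ᶠ y in 𝓝 v, energy L y = H (legendre L y) :=
    Filter.mem_of_superset ((isOpen_legendre_preimage hL hO).mem_nhds hv) hH.energy_eq
  have hspan : (v.2 - gam L H v : E) ∈ Submodule.span ℝ (range fun μ => (gam L (φ μ) v : E)) :=
    mem_span_range_of_forall_mem_range (B := fibreHessian L v)
      (fun β hβ => mem_range_fibreHessian hL hO hφ hv hsub hβ)
      (fibreHessian_apply_sub_gam_eq_zero hL (hH.smooth.contMDiffAt (hO.mem_nhds hv)) hE)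
  obtain ⟨c, hc⟩ := (Submodule.mem_span_range_iff_exists_fun ℝ).1 hspan
  exact ⟨c, eq_add_of_sub_eq' hc.symm⟩

theorem sub_fibreHessian_M_apply [Fintype ι] (hL : ContMDiff (modelTQ E) 𝓘(ℝ, ℝ) ∞ L) {v : TQ E Q}
    (hH : ContMDiffAt (modelCoTQ E) 𝓘(ℝ, ℝ) ∞ H (legendre L v))
    (hφ : ∀ μ, ContMDiffAt (modelCoTQ E) 𝓘(ℝ, ℝ) ∞ (φ μ) (legendre L v))
    {lam : ι → TQ E Q → ℝ} (hlam : ∀ μ, ContMDiffAt (modelTQ E) 𝓘(ℝ, ℝ) ∞ (lam μ) v)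
    (hres : ∀ᶠ y in 𝓝 v, y.2 = gam L H y + ∑ μ, lam μ y • gam L (φ μ) y) (α : E →L[ℝ] ℝ) :
    α - fibreHessian L v (M L H φ lam v α) =
      ∑ μ, α (gam L (φ μ) v) • (fibreDeriv (lam μ) v : E →L[ℝ] ℝ) := by
  have htop : (2 : WithTop ℕ∞) ≤ ∞ := WithTop.coe_le_coe.2 le_top
  refine sub_hessian_apply_eq_sum (c := fun μ => lam μ ∘ fibreIncl v.proj)
    ((contDiff_comp_fibreIncl hL v.proj).contDiffAt.of_le htop)
    ((contDiffAt_comp_coFibreIncl hH).of_le htop)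
    (fun μ => (contDiffAt_comp_coFibreIncl (hφ μ)).of_le htop) (fun μ => ?_)
    ((contMDiff_fibreIncl v.proj).continuous.continuousAt.eventually hres) α
  exact (ContMDiffAt.comp (g := lam μ) _ (hlam μ)
    (contMDiff_fibreIncl v.proj _)).contDiffAt.differentiableAt (by simp)

/-! ### Smoothness of the resolutions -/

/-- The fibre derivative of `h` in the natural chart at `q₀`. -/
def coLocDeriv (h : CoTQ E Q → ℝ) (q₀ : Q) (z : E × (E →L[ℝ] ℝ)) : E :=
  dualGradient (fun η => coLoc h q₀ (z.1, η)) z.2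

/-- The fibre hessian of `h` in the natural chart at `q₀`. -/
def coLocHessian (h : CoTQ E Q → ℝ) (q₀ : Q) (z : E × (E →L[ℝ] ℝ)) : (E →L[ℝ] ℝ) →L[ℝ] E :=
  fderiv ℝ (dualGradient fun η => coLoc h q₀ (z.1, η)) z.2

theorem contDiffAt_coLocDeriv {q₀ : Q} {p : CoTQ E Q}
    (hh : ContMDiffAt (modelCoTQ E) 𝓘(ℝ, ℝ) ∞ h p) (hq : p.proj ∈ (chartAt E q₀).source) :
    ContDiffAt ℝ ∞ (coLocDeriv h q₀) (coChart q₀ p) :=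
  contDiffAt_dualGradient (K := fun z : E × (E →L[ℝ] ℝ) => fun η => coLoc h q₀ (z.1, η))
    (g := Prod.snd) (ContDiffAt.comp (g := coLoc h q₀) (coChart q₀ p, (coChart q₀ p).2)
      (contDiffAt_coLoc hh hq) (contDiffAt_fst.fst.prodMk contDiffAt_snd)) contDiffAt_snd le_rfl

theorem contDiffAt_coLocHessian {q₀ : Q} {p : CoTQ E Q}
    (hh : ContMDiffAt (modelCoTQ E) 𝓘(ℝ, ℝ) ∞ h p) (hq : p.proj ∈ (chartAt E q₀).source) :
    ContDiffAt ℝ ∞ (coLocHessian h q₀) (coChart q₀ p) :=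
  contDiffAt_fderiv_dualGradient (K := fun z : E × (E →L[ℝ] ℝ) => fun η => coLoc h q₀ (z.1, η))
    (g := Prod.snd) (ContDiffAt.comp (g := coLoc h q₀) (coChart q₀ p, (coChart q₀ p).2)
      (contDiffAt_coLoc hh hq) (contDiffAt_fst.fst.prodMk contDiffAt_snd)) contDiffAt_snd le_rfl

theorem toFrame_coFibreDeriv {q₀ q : Q} {β : E →L[ℝ] ℝ}
    (hh : ContMDiffAt (modelCoTQ E) 𝓘(ℝ, ℝ) ∞ h (coFibreIncl q β))
    (hq : q ∈ (chartAt E q₀).source) :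
    toFrame (E := E) q₀ q (coFibreDeriv h (coFibreIncl q β)) =
      coLocDeriv h q₀ (coChart q₀ (coFibreIncl q β)) := by
  have hβ := coChart_snd_comp_toFrame hq β
  have hk : DifferentiableAt ℝ (h ∘ coFibreIncl q)
      ((coChart q₀ (coFibreIncl q β)).2.comp (toFrame q₀ q)) := by
    rw [hβ]
    exact (contDiffAt_comp_coFibreIncl hh).differentiableAt (by simp)
  rw [coLocDeriv, coLoc_comp_toFrame h hq]
  refine Eq.trans ?_ (dualGradient_precomp hk).symm
  rw [hβ]
  rfl

theorem toFrame_coFibreHessian {q₀ q : Q} {β : E →L[ℝ] ℝ}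
    (hh : ContMDiffAt (modelCoTQ E) 𝓘(ℝ, ℝ) ∞ h (coFibreIncl q β))
    (hq : q ∈ (chartAt E q₀).source) (α : E →L[ℝ] ℝ) :
    toFrame (E := E) q₀ q (coFibreHessian h (coFibreIncl q β) (α.comp (toFrame (E := E) q₀ q))) =
      coLocHessian h q₀ (coChart q₀ (coFibreIncl q β)) α := by
  have hβ := coChart_snd_comp_toFrame hq β
  have hk : ContDiffAt ℝ 2 (h ∘ coFibreIncl q)
      ((coChart q₀ (coFibreIncl q β)).2.comp (toFrame q₀ q)) := by
    rw [hβ]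
    exact (contDiffAt_comp_coFibreIncl hh).of_le (WithTop.coe_le_coe.2 le_top)
  rw [coLocHessian, coLoc_comp_toFrame h hq]
  refine Eq.trans ?_ (fderiv_dualGradient_precomp hk α).symm
  rw [hβ]
  rfl

theorem contMDiffAt_toFrame_gam (hL : ContMDiff (modelTQ E) 𝓘(ℝ, ℝ) ∞ L) (hO : IsOpen O)
    (hh : ContMDiffOn (modelCoTQ E) 𝓘(ℝ, ℝ) ∞ h O) {v : TQ E Q} (hv : legendre L v ∈ O) :
    ContMDiffAt (modelTQ E) 𝓘(ℝ, E) ∞ (fun y => toFrame (E := E) v.proj y.proj (gam L h y)) v := by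
  have hq : v.proj ∈ (chartAt E v.proj).source := mem_chart_source E v.proj
  refine ((contDiffAt_coLocDeriv (hh.contMDiffAt (hO.mem_nhds hv)) hq).contMDiffAt.comp v
    (contMDiffAt_coChart_legendre hL hq)).congr_of_eventuallyEq ?_
  filter_upwards [eventually_proj_mem_chartAt_source v,
    (isOpen_legendre_preimage hL hO).mem_nhds hv] with y hyq hyO
  exact toFrame_coFibreDeriv (hh.contMDiffAt (hO.mem_nhds hyO)) hyq

theorem exists_isResolution [Fintype ι] (hL : ContMDiff (modelTQ E) 𝓘(ℝ, ℝ) ∞ L)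
    (hO : IsOpen O) (hφ : IsIndependentPrimaryConstraints L O φ) (hH : IsHamiltonian L O H)
    (hsub : ∀ v, legendre L v ∈ O →
      tangentSubspace (modelCoTQ E) (range (legendre L)) (legendre L v) ≤
        (mfderiv (modelTQ E) (modelCoTQ E) (legendre L) v).range) :
    ∃ lam : ι → TQ E Q → ℝ, IsResolution L H φ (legendre L ⁻¹' O) lam := by
  choose! lam hlam using fun v (hv : v ∈ legendre L ⁻¹' O) =>
    exists_eq_gam_add_sum hL hO hφ hH hv (hsub v hv)
  refine ⟨fun μ v => lam v μ, fun μ v hv => ContMDiffAt.contMDiffWithinAt ?_, hlam⟩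
  have hi : LinearIndependent ℝ fun μ => toFrame (E := E) v.proj v.proj (gam L (φ μ) v) := by
    simpa only [toFrame_self] using! linearIndependent_gam hL (hφ.contMDiffAt hO hv)
      (hφ.eventually_apply_legendre hL hO hv) (hφ.independent _ ⟨mem_range_self v, hv⟩)
  refine contMDiffAt_coefficients (c := fun μ y => lam y μ)
    (γ := fun μ (y : TQ E Q) => toFrame (E := E) v.proj y.proj (gam L (φ μ) y))
    (fun μ => contMDiffAt_toFrame_gam hL hO (hφ.smooth μ) hv)
    (contMDiffAt_toFrame_snd.sub (contMDiffAt_toFrame_gam hL hO hH.smooth hv)) hi ?_ μ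
  filter_upwards [(isOpen_legendre_preimage hL hO).mem_nhds hv] with y hy
  refine sub_eq_of_eq_add' ?_
  have hlin : ∀ (A : E →L[ℝ] E) (a : E) (c : ι → ℝ) (b : ι → E),
      A (a + ∑ μ, c μ • b μ) = A a + ∑ μ, c μ • A (b μ) := fun A a c b => by
    simp only [map_add, map_sum, map_smul]
  exact (congrArg (toFrame (E := E) v.proj y.proj) (hlam y hy)).trans (hlin _ _ _ _)

/-! ### The Euler-Lagrange form of `D₀` -/

variable [Fintype ι] {lam : ι → TQ E Q → ℝ} {X₀ : ∀ v : TQ E Q, TangentSpace (modelTQ E) v}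

theorem chi_eq (L : TQ E Q → ℝ) (h : CoTQ E Q → ℝ)
    (X₀ : ∀ v : TQ E Q, TangentSpace (modelTQ E) v) (v : TQ E Q) :
    chi L h X₀ v = eulerLagrange L v (X₀ v) (gam L h v) :=
  eulerLagrangeHat_verticalLift L v (X₀ v) (gam L h v)

theorem D₀_eq (L : TQ E Q → ℝ) (H : CoTQ E Q → ℝ) (φ : ι → CoTQ E Q → ℝ) (lam : ι → TQ E Q → ℝ)
    (X₀ : ∀ v : TQ E Q, TangentSpace (modelTQ E) v) (v : TQ E Q) :
    D₀ L H φ lam X₀ v = X₀ v + verticalLift v (M L H φ lam v (eulerLagrange L v (X₀ v))) := by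
  have hα : (LinearMap.toContinuousLinearMap
      (eulerLagrangeHat L v (X₀ v) ∘ₗ (verticalLift v).toLinearMap : E →ₗ[ℝ] ℝ)) =
      eulerLagrange L v (X₀ v) :=
    ContinuousLinearMap.ext (eulerLagrangeHat_verticalLift L v (X₀ v))
  rw [← hα]
  rfl

theorem eulerLagrangeHat_D₀ (hL : ContMDiff (modelTQ E) 𝓘(ℝ, ℝ) ∞ L) {v : TQ E Q}
    (hH : ContMDiffAt (modelCoTQ E) 𝓘(ℝ, ℝ) ∞ H (legendre L v))
    (hφ : ∀ μ, ContMDiffAt (modelCoTQ E) 𝓘(ℝ, ℝ) ∞ (φ μ) (legendre L v))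
    (hlam : ∀ μ, ContMDiffAt (modelTQ E) 𝓘(ℝ, ℝ) ∞ (lam μ) v)
    (hres : ∀ᶠ y in 𝓝 v, y.2 = gam L H y + ∑ μ, lam μ y • gam L (φ μ) y)
    (X₀ : ∀ v : TQ E Q, TangentSpace (modelTQ E) v) :
    eulerLagrangeHat L v (D₀ L H φ lam X₀ v) =
      ∑ μ, chi L (φ μ) X₀ v • verticalCovector v (fibreDeriv (lam μ) v) := by
  let α : E →L[ℝ] ℝ := eulerLagrange L v (X₀ v)
  ext Y
  obtain ⟨a, rfl⟩ := (verticalLift v).surjective Y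
  have hcov : ∀ β : E →L[ℝ] ℝ, verticalCovector v β (verticalLift v a) = β a := fun β =>
    congrArg β ((verticalLift v).symm_apply_apply a)
  calc eulerLagrangeHat L v (D₀ L H φ lam X₀ v) (verticalLift v a)
      = eulerLagrange L v (D₀ L H φ lam X₀ v) a := eulerLagrangeHat_verticalLift L v _ a
    _ = α a - fibreHessian L v (M L H φ lam v α) a := by
      rw [D₀_eq]
      exact eulerLagrange_add_verticalLift_apply hL v (X₀ v) _ a
    _ = (∑ μ, α (gam L (φ μ) v) • (fibreDeriv (lam μ) v : E →L[ℝ] ℝ)) a :=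
      DFunLike.congr_fun (sub_fibreHessian_M_apply hL hH hφ hlam hres α) a
    _ = (∑ μ, chi L (φ μ) X₀ v • verticalCovector v (fibreDeriv (lam μ) v))
        (verticalLift v a) := by
      rw [sum_apply, LinearMap.sum_apply]
      exact Finset.sum_congr rfl fun μ _ =>
        congrArg₂ (· * ·) (chi_eq L (φ μ) X₀ v).symm (hcov (fibreDeriv (lam μ) v)).symm

/-- At the points of `V₁` the covector `δL(X₀)` lies in the image of the fibre hessian, which
annihilates `γ_h`. -/
theorem chi_eq_zero (hL : ContMDiff (modelTQ E) 𝓘(ℝ, ℝ) ∞ L) {v : TQ E Q}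
    (hh : ContMDiffAt (modelCoTQ E) 𝓘(ℝ, ℝ) ∞ h (legendre L v))
    (h₀ : ∀ᶠ y in 𝓝 v, h (legendre L y) = 0) (hX₀ : X₀ v ∈ secondOrderVectors v)
    (hv : v ∈ primaryLagrangianSubset L) : chi L h X₀ v = 0 := by
  obtain ⟨X, hX, hEL⟩ := hv
  obtain ⟨u, hu⟩ := exists_eq_add_verticalLift hX hX₀
  rw [chi_eq, hu]
  refine (eulerLagrange_add_verticalLift_apply hL v X u (gam L h v)).trans ?_
  rw [fibreHessian_apply_gam_eq_zero hL hh h₀, sub_zero]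
  exact (eulerLagrangeHat_verticalLift L v X (gam L h v)).symm.trans (DFunLike.congr_fun hEL _)

/-! ### Smoothness of `D₀` -/

/-- The operator `M` in the natural charts at `q₀`. -/
def locM (L : TQ E Q → ℝ) (H : CoTQ E Q → ℝ) (φ : ι → CoTQ E Q → ℝ) (lam : ι → TQ E Q → ℝ)
    (q₀ : Q) (v : TQ E Q) : (E →L[ℝ] ℝ) →L[ℝ] E :=
  coLocHessian H q₀ (coChart q₀ (legendre L v)) +
    ∑ μ, lam μ v • coLocHessian (φ μ) q₀ (coChart q₀ (legendre L v))

theorem contMDiffAt_locM (hL : ContMDiff (modelTQ E) 𝓘(ℝ, ℝ) ∞ L) {q₀ : Q} {v : TQ E Q}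
    (hq : v.proj ∈ (chartAt E q₀).source)
    (hH : ContMDiffAt (modelCoTQ E) 𝓘(ℝ, ℝ) ∞ H (legendre L v))
    (hφ : ∀ μ, ContMDiffAt (modelCoTQ E) 𝓘(ℝ, ℝ) ∞ (φ μ) (legendre L v))
    (hlam : ∀ μ, ContMDiffAt (modelTQ E) 𝓘(ℝ, ℝ) ∞ (lam μ) v) :
    ContMDiffAt (modelTQ E) 𝓘(ℝ, (E →L[ℝ] ℝ) →L[ℝ] E) ∞ (locM L H φ lam q₀) v := by
  have hhess : ∀ {h : CoTQ E Q → ℝ}, ContMDiffAt (modelCoTQ E) 𝓘(ℝ, ℝ) ∞ h (legendre L v) →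
      ContMDiffAt (modelTQ E) 𝓘(ℝ, (E →L[ℝ] ℝ) →L[ℝ] E) ∞
        (fun y => coLocHessian h q₀ (coChart q₀ (legendre L y))) v := fun hh =>
    (contDiffAt_coLocHessian hh hq).contMDiffAt.comp v (contMDiffAt_coChart_legendre hL hq)
  exact (hhess hH).add (ContMDiffAt.sum fun μ _ => (hlam μ).smul (hhess (hφ μ)))

theorem toFrame_M {q₀ : Q} {v : TQ E Q} (hq : v.proj ∈ (chartAt E q₀).source)
    (hH : ContMDiffAt (modelCoTQ E) 𝓘(ℝ, ℝ) ∞ H (legendre L v))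
    (hφ : ∀ μ, ContMDiffAt (modelCoTQ E) 𝓘(ℝ, ℝ) ∞ (φ μ) (legendre L v))
    (lam : ι → TQ E Q → ℝ) (α : E →L[ℝ] ℝ) :
    toFrame (E := E) q₀ v.proj (M L H φ lam v (α.comp (toFrame (E := E) q₀ v.proj))) =
      locM L H φ lam q₀ v α := by
  have hlin : ∀ (A : E →L[ℝ] E) (B : (E →L[ℝ] ℝ) →L[ℝ] E) (C : ι → (E →L[ℝ] ℝ) →L[ℝ] E)
      (β : E →L[ℝ] ℝ), A ((B + ∑ μ, lam μ v • C μ) β) = A (B β) + ∑ μ, lam μ v • A (C μ β) :=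
    fun A B C β => by simp only [add_apply, sum_apply, smul_apply, map_add, map_sum, map_smul]
  refine (hlin _ _ _ _).trans (Eq.trans ?_ (hlin (.id ℝ E) _ _ α).symm)
  exact congrArg₂ (· + ·) (toFrame_coFibreHessian hH hq α)
    (Finset.sum_congr rfl fun μ _ => congrArg (lam μ v • ·) (toFrame_coFibreHessian (hφ μ) hq α))

theorem toFrameTQ_D₀ (hL : ContMDiff (modelTQ E) 𝓘(ℝ, ℝ) ∞ L) {q₀ : Q} {v : TQ E Q}
    (hq : v.proj ∈ (chartAt E q₀).source)
    (hH : ContMDiffAt (modelCoTQ E) 𝓘(ℝ, ℝ) ∞ H (legendre L v))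
    (hφ : ∀ μ, ContMDiffAt (modelCoTQ E) 𝓘(ℝ, ℝ) ∞ (φ μ) (legendre L v))
    (lam : ι → TQ E Q → ℝ) (hX₀ : X₀ v ∈ secondOrderVectors v) :
    toFrameTQ q₀ v (D₀ L H φ lam X₀ v) = toFrameTQ q₀ v (X₀ v) +
      (0, locM L H φ lam q₀ v (elForm (loc L q₀) (tqChart q₀ v) (toFrameTQ q₀ v (X₀ v)))) := by
  rw [D₀_eq, eulerLagrange_eq_elForm_toFrame hL hq (mem_secondOrderVectors.1 hX₀)]
  refine (map_add (toFrameTQ q₀ v) _ _).trans (congrArg _ ?_)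
  exact (congrArg (toFrameTQ q₀ v) (coe_verticalLift v _)).trans
    ((toFrameTQ_vertical hq _).trans (congrArg (Prod.mk 0) (toFrame_M hq hH hφ lam _)))

theorem isSecondOrderField_D₀ (hL : ContMDiff (modelTQ E) 𝓘(ℝ, ℝ) ∞ L) {U : Set (TQ E Q)}
    (hU : IsOpen U) (hH : ∀ v ∈ U, ContMDiffAt (modelCoTQ E) 𝓘(ℝ, ℝ) ∞ H (legendre L v))
    (hφ : ∀ v ∈ U, ∀ μ, ContMDiffAt (modelCoTQ E) 𝓘(ℝ, ℝ) ∞ (φ μ) (legendre L v))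
    (hlam : ∀ μ, ContMDiffOn (modelTQ E) 𝓘(ℝ, ℝ) ∞ (lam μ) U) (hX₀ : IsSecondOrderField U X₀) :
    IsSecondOrderField U (D₀ L H φ lam X₀) := by
  refine ⟨fun v hv => ContMDiffAt.contMDiffWithinAt ?_, fun v hv => ?_⟩
  · have hq := mem_chart_source E v.proj
    have hX := (contMDiffAt_field_iff v).1 (hX₀.smooth.contMDiffAt (hU.mem_nhds hv))
    have hEL : ContMDiffAt (modelTQ E) 𝓘(ℝ, E →L[ℝ] ℝ) ∞ (fun y => elForm (loc L v.proj)
        (tqChart v.proj y) (toFrameTQ v.proj y (X₀ y))) v :=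
      (contDiffAt_elForm (contDiffAt_loc (hL v) hq) _).contMDiffAt.comp v
        ((contMDiffAt_tqChart hq).prodMk_space hX)
    have hM := contMDiffAt_locM hL hq (hH v hv) (hφ v hv)
      fun μ => (hlam μ).contMDiffAt (hU.mem_nhds hv)
    have hcorrection := (contMDiffAt_const (c := (0 : E))).prodMk_space (hM.clm_apply hEL)
    refine (contMDiffAt_field_iff v).2 ((hX.add hcorrection).congr_of_eventuallyEq ?_)
    filter_upwards [eventually_proj_mem_chartAt_source v, hU.mem_nhds hv] with y hyq hy
    exact toFrameTQ_D₀ hL hyq (hH y hy) (hφ y hy) lam (hX₀.secondOrder y hy)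
  · rw [D₀_eq]
    exact add_verticalLift_mem_secondOrderVectors (hX₀.secondOrder v hv) _

end

end SingularLagrangian

theorem proposition5_general {E : Type*} [NormedAddCommGroup E] [NormedSpace ℝ E]
    [FiniteDimensional ℝ E]
    {Q : Type*} [TopologicalSpace Q] [ChartedSpace E Q] [IsManifold 𝓘(ℝ, E) ∞ Q]
    {ι : Type*} [Fintype ι]
    (L : TQ E Q → ℝ) (hL : ContMDiff (modelTQ E) 𝓘(ℝ, ℝ) ∞ L)
    (O : Set (CoTQ E Q)) (hO : IsOpen O)
    (hsub : ∀ v, legendre L v ∈ O →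
      tangentSubspace (modelCoTQ E) (range (legendre L)) (legendre L v) ≤
        (mfderiv (modelTQ E) (modelCoTQ E) (legendre L) v).range)
    (φ : ι → CoTQ E Q → ℝ) (hφ : IsIndependentPrimaryConstraints L O φ)
    (H : CoTQ E Q → ℝ) (hH : IsHamiltonian L O H) :
    (∃ lam : ι → TQ E Q → ℝ, IsResolution L H φ (legendre L ⁻¹' O) lam) ∧
    ∀ (U : Set (TQ E Q)), IsOpen U → U ⊆ legendre L ⁻¹' O →
      ∀ lam : ι → TQ E Q → ℝ, IsResolution L H φ U lam →
      ∀ X₀ : (∀ v : TQ E Q, TangentSpace (modelTQ E) v), IsSecondOrderField U X₀ →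
        IsPrimaryField L U (D₀ L H φ lam X₀) ∧
        (∀ v ∈ U, eulerLagrangeHat L v (D₀ L H φ lam X₀ v) =
          ∑ μ, chi L (φ μ) X₀ v • verticalCovector v (fibreDeriv (lam μ) v)) ∧
        ∀ v ∈ primaryLagrangianSubset L ∩ U,
          ∑ μ, chi L (φ μ) X₀ v • verticalCovector v (fibreDeriv (lam μ) v) = 0 := by
  refine ⟨exists_isResolution hL hO hφ hH hsub, fun U hU hUO lam hlam X₀ hX₀ => ?_⟩
  have hH' : ∀ v ∈ U, ContMDiffAt (modelCoTQ E) 𝓘(ℝ, ℝ) ∞ H (legendre L v) := fun v hv =>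
    hH.smooth.contMDiffAt (hO.mem_nhds (hUO hv))
  have hφ' : ∀ v ∈ U, ∀ μ, ContMDiffAt (modelCoTQ E) 𝓘(ℝ, ℝ) ∞ (φ μ) (legendre L v) :=
    fun v hv => hφ.contMDiffAt hO (hUO hv)
  have hEL : ∀ v ∈ U, eulerLagrangeHat L v (D₀ L H φ lam X₀ v) =
      ∑ μ, chi L (φ μ) X₀ v • verticalCovector v (fibreDeriv (lam μ) v) := fun v hv =>
    eulerLagrangeHat_D₀ hL (hH' v hv) (hφ' v hv)
      (fun μ => (hlam.smooth μ).contMDiffAt (hU.mem_nhds hv))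
      (Filter.mem_of_superset (hU.mem_nhds hv) hlam.eq) X₀
  have hzero : ∀ v ∈ primaryLagrangianSubset L ∩ U,
      ∑ μ, chi L (φ μ) X₀ v • verticalCovector v (fibreDeriv (lam μ) v) = 0 := fun v hv =>
    Finset.sum_eq_zero fun μ _ => by
      rw [chi_eq_zero hL (hφ' v hv.2 μ) (hφ.eventually_apply_legendre hL hO (hUO hv.2) μ)
        (hX₀.secondOrder v hv.2) hv.1, zero_smul]
  exact ⟨⟨isSecondOrderField_D₀ hL hU hH' hφ' hlam.smooth hX₀,
    fun v hv => (hEL v hv.2).trans (hzero v hv)⟩, hEL, hzero⟩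

theorem proposition5 {E : Type*} [NormedAddCommGroup E] [NormedSpace ℝ E] [FiniteDimensional ℝ E]
    {Q : Type*} [TopologicalSpace Q] [ChartedSpace E Q] [IsManifold 𝓘(ℝ, E) ∞ Q]
    {ι : Type*} [Fintype ι]
    (L : TQ E Q → ℝ) (hL : ContMDiff (modelTQ E) 𝓘(ℝ, ℝ) ∞ L) (hreg : AlmostRegular L)
    (O : Set (CoTQ E Q)) (hO : IsOpen O)
    (φ : ι → CoTQ E Q → ℝ) (hφ : IsIndependentPrimaryConstraints L O φ)
    (H : CoTQ E Q → ℝ) (hH : IsHamiltonian L O H) :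
    (∃ lam : ι → TQ E Q → ℝ, IsResolution L H φ (legendre L ⁻¹' O) lam) ∧
    ∀ (U : Set (TQ E Q)), IsOpen U → U ⊆ legendre L ⁻¹' O →
      ∀ lam : ι → TQ E Q → ℝ, IsResolution L H φ U lam →
      ∀ X₀ : (∀ v : TQ E Q, TangentSpace (modelTQ E) v), IsSecondOrderField U X₀ →
        IsPrimaryField L U (D₀ L H φ lam X₀) ∧
        (∀ v ∈ U, eulerLagrangeHat L v (D₀ L H φ lam X₀ v) =
          ∑ μ, chi L (φ μ) X₀ v • verticalCovector v (fibreDeriv (lam μ) v)) ∧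
        ∀ v ∈ primaryLagrangianSubset L ∩ U,
          ∑ μ, chi L (φ μ) X₀ v • verticalCovector v (fibreDeriv (lam μ) v) = 0 :=
  proposition5_general L hL O hO (fun v _ => (hreg.submersion v).ge) φ hφ H hH
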